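/- Let $K$ be a finite extension of $\mathbb{Q}$. For a power series $h=\sum a_{i_0,\dots,i_n}x_0^{i_0}\cdots x_n^{i_n}\in K[[x_0,\dots,x_n]]$ write $\Delta_n(h)=\sum_{i\ge 0}a_{i,\dots,i}x^i\in K[[x]]$ for its diagonal, let $K\{x_0,\dots,x_n\}\subset K[[x_0,\dots,x_n]]$ be the subring of series algebraic over $K(x_0,\dots,x_n)$, and regard $K[x_0,\dots,x_n]_{(x_0,\dots,x_n)}$, the ring of rational functions $P/Q$ with $Q(0,\dots,0)\ne 0$, as a subring of $K[[x_0,\dots,x_n]]$ by Taylor expansion at the origin. For $f\in K[[x]]$ let $\mathbf{dg}(f)\in\{0,1,2,\dots,\infty\}$ be the smallest $n\ge 0$ such that $f=\Delta_n(h)$ for some $h\in K[x_0,\dots,x_n]_{(x_0,\dots,x_n)}$ ($\infty$ if there is no such $n$). Let $\mathbf{hg}(f)$ be $0$ if $f$ is rational, and otherwise the smallest $k\ge 1$ such that $f$ is the Hadamard (coefficientwise) product $h_1*\cdots*h_k$ of $k$ series $h_i\in K[[x]]$ algebraic over $K(x)$ ($\infty$ if there is no such $k$). Let $f\in K[[x]]$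 be $D$-finite, i.e. annihilated by a nonzero linear differential operator in $x\frac{d}{dx}$ with coefficients in $K(x)$. Then for every integer $n\ge 0$ the following are equivalent: (I) there is $g\in K\{x_0,\dots,x_n\}$ with $f=\Delta_n(g)$; (II) there is $h\in K[x_0,\dots,x_{n+1}]_{(x_0,\dots,x_{n+1})}$ with $f=\Delta_{n+1}(h)$. In particular, $\mathbf{dg}(f)\le\mathbf{hg}(f)$. -/

import Mathlib

namespace DiagonalGrade

open scoped Polynomial

noncomputable section

variable {K : Type*} [Field K]

/-- The operator `x * d/dx` on univariate power series. -/
def eulerDeriv (f : PowerSeries K) : PowerSeries K :=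
  PowerSeries.X * PowerSeries.derivative K f

/-- `f` is D-finite: it is annihilated by a nonzero linear differential operator
`∑ i ≤ r, p i * (x * d/dx) ^ i`. Polynomial coefficients suffice, since the denominators of an
operator with coefficients in `K(x)` can be cleared. -/
def IsDFinite (f : PowerSeries K) : Prop :=
  ∃ (r : ℕ) (p : Fin (r + 1) → K[X]), p ≠ 0 ∧
    ∑ i : Fin (r + 1), (p i : PowerSeries K) * eulerDeriv^[(i : ℕ)] f = 0

/-- `h` is the Taylor expansion at the origin of a rational function `P / Q` with `Q(0) ≠ 0`,
i.e. `h` lies in the localization of `K[x_0, …, x_n]` at `(x_0, …, x_n)`, seen inside the ring of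
formal power series. -/
def IsRegularRational {n : ℕ} (h : MvPowerSeries (Fin (n + 1)) K) : Prop :=
  ∃ P Q : MvPolynomial (Fin (n + 1)) K, MvPolynomial.constantCoeff Q ≠ 0 ∧
    (Q : MvPowerSeries (Fin (n + 1)) K) * h = P

/-- `g` is algebraic over the polynomials (equivalently, over the rational functions) in
`x_0, …, x_n`. -/
def IsAlgebraicSeries {n : ℕ} (g : MvPowerSeries (Fin (n + 1)) K) : Prop :=
  IsAlgebraic (MvPolynomial (Fin (n + 1)) K) g

/-- The diagonal `∑ i, a_{i,…,i} x ^ i` of a series in the variables `x_0, …, x_n`. -/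
def diagonal {n : ℕ} (h : MvPowerSeries (Fin (n + 1)) K) : PowerSeries K :=
  PowerSeries.mk fun i => MvPowerSeries.coeff (Finsupp.equivFunOnFinite.symm fun _ => i) h

/-- The smallest `n` such that `f` is the diagonal of a rational function in `x_0, …, x_n` regular
at the origin, and `⊤` if there is none. -/
def diagonalGrade (f : PowerSeries K) : ℕ∞ :=
  sInf {k : ℕ∞ | ∃ n : ℕ, k = n ∧
    ∃ h : MvPowerSeries (Fin (n + 1)) K, IsRegularRational h ∧ f = diagonal h}

/-- The univariate series `f` is (the expansion of) a rational function. -/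
def IsRationalSeries (f : PowerSeries K) : Prop :=
  ∃ P Q : K[X], Q ≠ 0 ∧ (Q : PowerSeries K) * f = P

/-- The Hadamard (coefficientwise) product of `k` univariate series. -/
def hadamardProd {k : ℕ} (h : Fin k → PowerSeries K) : PowerSeries K :=
  PowerSeries.mk fun m => ∏ i, PowerSeries.coeff m (h i)

open Classical in
/-- `0` for a rational series, otherwise the smallest `k ≥ 1` such that `f` is the Hadamard product
of `k` algebraic series, and `⊤` if there is none. -/
def hadamardGrade (f : PowerSeries K) : ℕ∞ :=
  if IsRationalSeries f then 0 else
    sInf {l : ℕ∞ | ∃ k : ℕ, l = k ∧ 1 ≤ k ∧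
      ∃ h : Fin k → PowerSeries K, (∀ i, IsAlgebraic K[X] (h i)) ∧ f = hadamardProd h}

end

end DiagonalGrade

namespace DiagonalGrade

open scoped Polynomial

noncomputable section

variable {K : Type*} [Field K]

/-! From algebraic to rational, the source is Furstenberg's formula. Let `z` be a root of `F(t, Y)`
with `t_0 ∣ z` and `∂F/∂Y ≠ 0` at the origin. Then the monomials of `y² F_Y / F` at `(t_0 y, t_1, …,
t_n, y)` having equal exponents in `y` and `t_0` are exactly those of `z(t_0 y, t_1, …, t_n)`
(`exists_isRegularRational_of_simple_root`).

A general algebraic `g` is reduced to this case by `x_i ↦ t_i (t_0 ⋯ t_n)^{w_i}`. In characteristic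
zero some `p` has `p(g) = 0` and `p'(g) ≠ 0`, and suitable weights turn `p'(g)` into a monomial
times a unit. Truncating `g` far enough and rescaling as in Newton's method leaves a simple root
(`exists_simple_root_form`). The substitution multiplies diagonal exponents by `d = 1 + ∑ w_i`. This
is undone by keeping only exponents divisible by `d`, which preserves regular rational functions
(`IsRegularRational.multisection`).

From rational to algebraic, the diagonal of `h` is that of the constant term in `y` of `h(y, x_0/y,
x_1, …, x_n)`. Weierstrass preparation splits its denominator into coprime factors `S L` with
algebraic coefficients, where `S` is distinguished and `L` is invertible at the origin. In the
partial fractions `b/L + a/S`, the first term expands in powers of `y` and contributes `b(0)/L(0)`.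
The second expands in negative powers of `y` and contributes nothing, so the constant term is
algebraic (`isAlgebraicSeries_constantTerm`).

The inequality of grades follows because a Hadamard product of `k` algebraic series is the diagonal
of the algebraic series `∏ h_i(x_i)`. -/

/-- The power series with a given family of coefficients. -/
def ofCoeff {σ R : Type*} (c : (σ →₀ ℕ) → R) : MvPowerSeries σ R :=
  c

@[simp]
theorem coeff_ofCoeff {σ R : Type*} [Semiring R] (c : (σ →₀ ℕ) → R) (e : σ →₀ ℕ) :
    MvPowerSeries.coeff e (ofCoeff c) = c e :=
  rfl

/-! ### Monomial substitutions. -/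

section MonomialMap

variable {σ τ υ : Type*}

/-- Extension by zero along `φ` respects convolution: only splittings with both parts in the range
contribute, the range is closed under addition, and injectivity matches them with splittings
upstairs. This is the multiplicativity of `monomialMap`. -/
theorem extend_antidiagonal_sum (φ : (σ →₀ ℕ) →+ (τ →₀ ℕ)) (hφ : Function.Injective φ)
    (f g : (σ →₀ ℕ) → K) (e : τ →₀ ℕ) [DecidableEq σ] [DecidableEq τ] :
    ∑ p ∈ Finset.HasAntidiagonal.antidiagonal e,
        Function.extend φ f 0 p.1 * Function.extend φ g 0 p.2 =
      Function.extend φ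
        (fun u => ∑ p ∈ Finset.HasAntidiagonal.antidiagonal u, f p.1 * g p.2) 0 e := by
  by_cases he : ∃ u, φ u = e
  · obtain ⟨u, rfl⟩ := he
    rw [hφ.extend_apply]
    symm
    refine Finset.sum_of_injOn (fun p => (φ p.1, φ p.2)) ?_ ?_ ?_ ?_
    · rintro ⟨a, b⟩ _ ⟨c, d⟩ _ h
      simp only [Prod.mk.injEq] at h
      exact Prod.ext (hφ h.1) (hφ h.2)
    · rintro ⟨a, b⟩ h
      simp only [Finset.mem_coe, Finset.HasAntidiagonal.mem_antidiagonal] at h ⊢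
      rw [← map_add, h]
    · rintro ⟨a, b⟩ h hn
      by_cases ha : ∃ a', φ a' = a
      · by_cases hb : ∃ b', φ b' = b
        · obtain ⟨a', rfl⟩ := ha
          obtain ⟨b', rfl⟩ := hb
          refine absurd ⟨(a', b'), ?_, rfl⟩ hn
          simp only [Finset.HasAntidiagonal.mem_antidiagonal, Finset.mem_coe] at h ⊢
          exact hφ (by rw [map_add, h])
        · simp [Function.extend_apply' _ _ _ hb]
      · simp [Function.extend_apply' _ _ _ ha]
    · rintro ⟨a, b⟩ h
      simp [hφ.extend_apply]
  · rw [Function.extend_apply' _ _ _ he]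
    refine Finset.sum_eq_zero ?_
    rintro ⟨a, b⟩ h
    by_cases ha : ∃ a', φ a' = a
    · by_cases hb : ∃ b', φ b' = b
      · obtain ⟨a', rfl⟩ := ha
        obtain ⟨b', rfl⟩ := hb
        exact absurd ⟨a' + b', by simpa using h⟩ he
      · simp [Function.extend_apply' _ _ _ hb]
    · simp [Function.extend_apply' _ _ _ ha]

/-- The substitution of monomials into a power series, described by the injective map `φ` that it
induces on exponents. -/
def monomialMap (φ : (σ →₀ ℕ) →+ (τ →₀ ℕ)) (hφ : Function.Injective φ) :
    MvPowerSeries σ K →+* MvPowerSeries τ K where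
  toFun f := ofCoeff (Function.extend φ (fun u => MvPowerSeries.coeff u f) 0)
  map_one' := by
    classical
    ext e
    rw [coeff_ofCoeff]
    by_cases he : ∃ u, φ u = e
    · obtain ⟨u, rfl⟩ := he
      rw [hφ.extend_apply, MvPowerSeries.coeff_one, MvPowerSeries.coeff_one]
      simp [map_eq_zero_iff φ hφ]
    · rw [Function.extend_apply' _ _ _ he, MvPowerSeries.coeff_one, if_neg]
      · rfl
      · rintro rfl
        exact he ⟨0, map_zero φ⟩
  map_mul' f g := by
    classical
    ext e
    simp only [MvPowerSeries.coeff_mul, coeff_ofCoeff, extend_antidiagonal_sum φ hφ]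
  map_zero' := by
    ext e
    rw [coeff_ofCoeff]
    by_cases he : ∃ u, φ u = e
    · obtain ⟨u, rfl⟩ := he
      simp [hφ.extend_apply]
    · rw [Function.extend_apply' _ _ _ he]
      rfl
  map_add' f g := by
    ext e
    simp only [map_add, coeff_ofCoeff]
    by_cases he : ∃ u, φ u = e
    · obtain ⟨u, rfl⟩ := he
      simp only [hφ.extend_apply]
    · simp [Function.extend_apply' _ _ _ he]

variable (φ : (σ →₀ ℕ) →+ (τ →₀ ℕ)) (hφ : Function.Injective φ)

@[simp]
theorem coeff_monomialMap (f : MvPowerSeries σ K) (u : σ →₀ ℕ) :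
    MvPowerSeries.coeff (φ u) (monomialMap φ hφ f) = MvPowerSeries.coeff u f :=
  hφ.extend_apply _ _ _

theorem coeff_monomialMap_of_notMem (f : MvPowerSeries σ K) {e : τ →₀ ℕ} (he : ∀ u, φ u ≠ e) :
    MvPowerSeries.coeff e (monomialMap φ hφ f) = 0 :=
  Function.extend_apply' _ _ _ (by simpa using he)

theorem exists_of_coeff_monomialMap_ne_zero {f : MvPowerSeries σ K} {e : τ →₀ ℕ}
    (he : MvPowerSeries.coeff e (monomialMap φ hφ f) ≠ 0) :
    ∃ u, φ u = e ∧ MvPowerSeries.coeff u f ≠ 0 := by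
  by_contra! h
  by_cases hu : ∃ u, φ u = e
  · obtain ⟨u, rfl⟩ := hu
    exact he (by rw [coeff_monomialMap, h u rfl])
  · exact he (coeff_monomialMap_of_notMem φ hφ f (by simpa using hu))

theorem constantCoeff_monomialMap (f : MvPowerSeries σ K) :
    MvPowerSeries.constantCoeff (monomialMap φ hφ f) = MvPowerSeries.constantCoeff f := by
  rw [← MvPowerSeries.coeff_zero_eq_constantCoeff_apply,
    ← MvPowerSeries.coeff_zero_eq_constantCoeff_apply, ← map_zero φ, coeff_monomialMap]

theorem monomialMap_monomial (u : σ →₀ ℕ) (r : K) :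
    monomialMap φ hφ (MvPowerSeries.monomial u r) = MvPowerSeries.monomial (φ u) r := by
  classical
  ext e
  by_cases he : ∃ v, φ v = e
  · obtain ⟨v, rfl⟩ := he
    rw [coeff_monomialMap, MvPowerSeries.coeff_monomial, MvPowerSeries.coeff_monomial]
    simp [hφ.eq_iff]
  · rw [coeff_monomialMap_of_notMem _ _ _ (by simpa using he), MvPowerSeries.coeff_monomial,
      if_neg]
    rintro rfl
    exact he ⟨u, rfl⟩

theorem monomialMap_monomialMap (ψ : (τ →₀ ℕ) →+ (υ →₀ ℕ)) (hψ : Function.Injective ψ)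
    (χ : (σ →₀ ℕ) →+ (υ →₀ ℕ)) (hχ : Function.Injective χ) (h : ∀ u, ψ (φ u) = χ u)
    (f : MvPowerSeries σ K) :
    monomialMap ψ hψ (monomialMap φ hφ f) = monomialMap χ hχ f := by
  ext e
  by_cases he : ∃ u, χ u = e
  · obtain ⟨u, rfl⟩ := he
    rw [coeff_monomialMap, ← h, coeff_monomialMap, coeff_monomialMap]
  · rw [coeff_monomialMap_of_notMem χ hχ _ (by simpa using he)]
    by_contra h0
    obtain ⟨v, rfl, hv⟩ := exists_of_coeff_monomialMap_ne_zero ψ hψ h0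
    obtain ⟨u, rfl, -⟩ := exists_of_coeff_monomialMap_ne_zero φ hφ hv
    exact he ⟨u, (h u).symm⟩

/-- The substitution of monomials into a polynomial. -/
def monomialMapPoly : MvPolynomial σ K →+* MvPolynomial τ K :=
  (MvPolynomial.aeval fun i => MvPolynomial.monomial (φ (Finsupp.single i 1)) (1 : K)).toRingHom

theorem coe_monomialMapPoly (P : MvPolynomial σ K) :
    ((monomialMapPoly φ P : MvPolynomial τ K) : MvPowerSeries τ K) =
      monomialMap φ hφ (P : MvPowerSeries σ K) := by
  have : (MvPolynomial.coeToMvPowerSeries.ringHom (σ := τ) (R := K)).comp (monomialMapPoly φ) =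
      (monomialMap φ hφ).comp (MvPolynomial.coeToMvPowerSeries.ringHom (σ := σ) (R := K)) := by
    refine MvPolynomial.ringHom_ext ?_ ?_
    · intro r
      simp only [RingHom.comp_apply, monomialMapPoly, AlgHom.toRingHom_eq_coe, RingHom.coe_coe,
        MvPolynomial.algHom_C, MvPolynomial.algebraMap_eq,
        MvPolynomial.coeToMvPowerSeries.ringHom_apply, MvPolynomial.coe_C]
      rw [← MvPowerSeries.monomial_zero_eq_C_apply, ← MvPowerSeries.monomial_zero_eq_C_apply,
        monomialMap_monomial, map_zero]
    · intro i
      simp only [RingHom.comp_apply, monomialMapPoly, AlgHom.toRingHom_eq_coe, RingHom.coe_coe,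
        MvPolynomial.aeval_X, MvPolynomial.coeToMvPowerSeries.ringHom_apply, MvPolynomial.coe_X,
        MvPolynomial.coe_monomial]
      rw [MvPowerSeries.X_def, monomialMap_monomial]
  exact congrArg (fun F => F P) this

end MonomialMap

/-! ### Recognizing polynomials among power series; division by monomials. -/

section FiniteSupport

variable {σ : Type*}

theorem constantCoeff_coe (P : MvPolynomial σ K) :
    MvPowerSeries.constantCoeff (P : MvPowerSeries σ K) = MvPolynomial.constantCoeff P := by
  rw [← MvPowerSeries.coeff_zero_eq_constantCoeff_apply, MvPolynomial.coeff_coe,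
    MvPolynomial.constantCoeff_eq]

theorem exists_coe_eq_of_finite (f : MvPowerSeries σ K)
    (hf : {e | MvPowerSeries.coeff e f ≠ 0}.Finite) :
    ∃ P : MvPolynomial σ K, (P : MvPowerSeries σ K) = f := by
  refine ⟨MvPowerSeries.truncFinset K hf.toFinset f, ?_⟩
  ext e
  rw [MvPolynomial.coeff_coe]
  by_cases he : e ∈ hf.toFinset
  · rw [MvPowerSeries.coeff_truncFinset_of_mem _ he]
  · rw [MvPowerSeries.coeff_truncFinset_eq_zero _ he]
    simpa [eq_comm] using he

theorem finite_coeff_coe_ne_zero (P : MvPolynomial σ K) :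
    {e | MvPowerSeries.coeff e (P : MvPowerSeries σ K) ≠ 0}.Finite := by
  refine P.support.finite_toSet.subset fun e he => ?_
  simpa using he

/-- A power series all of whose exponents are at least `c` is divisible by the monomial `c`. -/
theorem exists_monomial_mul_eq (f : MvPowerSeries σ K) (c : σ →₀ ℕ)
    (hf : ∀ e, MvPowerSeries.coeff e f ≠ 0 → c ≤ e) :
    ∃ g : MvPowerSeries σ K, f = MvPowerSeries.monomial c 1 * g := by
  classical
  refine ⟨ofCoeff fun e => MvPowerSeries.coeff (c + e) f, ?_⟩
  ext e
  rw [MvPowerSeries.coeff_monomial_mul]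
  split_ifs with h
  · rw [one_mul, coeff_ofCoeff, add_tsub_cancel_of_le h]
  · by_contra h0
    exact h (hf e h0)

/-- Allows a division by a monomial to be carried out on power series and its result to be taken
back to polynomials. -/
theorem exists_coe_eq_of_monomial_mul (P : MvPolynomial σ K) (c : σ →₀ ℕ) (g : MvPowerSeries σ K)
    (h : (P : MvPowerSeries σ K) = MvPowerSeries.monomial c 1 * g) :
    ∃ Q : MvPolynomial σ K, (Q : MvPowerSeries σ K) = g := by
  refine exists_coe_eq_of_finite g ?_
  refine ((finite_coeff_coe_ne_zero P).preimage
    (f := fun e => c + e) (add_right_injective c).injOn).subset fun e he => ?_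
  simp only [Set.mem_preimage, Set.mem_ofPred_eq]
  rw [h, MvPowerSeries.coeff_add_monomial_mul, one_mul]
  exact he

end FiniteSupport

/-! ### Multisection of rational series. -/

section Multisection

variable {σ : Type*}

/-- The series whose coefficient at `e` is the coefficient of `f` at `d • e`. -/
def multisection (d : ℕ) (f : MvPowerSeries σ K) : MvPowerSeries σ K :=
  ofCoeff fun e => MvPowerSeries.coeff (d • e) f

@[simp]
theorem coeff_multisection (d : ℕ) (f : MvPowerSeries σ K) (e : σ →₀ ℕ) :
    MvPowerSeries.coeff e (multisection d f) = MvPowerSeries.coeff (d • e) f :=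
  rfl

theorem smul_finsupp_injective {d : ℕ} (hd : d ≠ 0) :
    Function.Injective (fun e : σ →₀ ℕ => d • e) := by
  intro a b h
  ext i
  have := DFunLike.congr_fun h i
  simpa [hd] using this

theorem exists_smul_eq_of_coeff_expand_ne_zero {d : ℕ} (P : MvPolynomial σ K) {e : σ →₀ ℕ}
    (he : MvPolynomial.coeff e (MvPolynomial.expand d P) ≠ 0) : ∃ u, d • u = e := by
  have h : ∀ i, d ∣ e i := by
    intro i
    by_contra h
    exact he (MvPolynomial.coeff_expand_of_not_dvd P h)
  refine ⟨e.mapRange (fun m => m / d) (by simp), ?_⟩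
  ext i
  simpa using Nat.mul_div_cancel' (h i)

/-- If `a + b = d • e` and `a` is a multiple of `d`, so is `b`; hence multisection is linear over
polynomials in the `d`-th powers. -/
theorem multisection_expand_mul {d : ℕ} (hd : d ≠ 0) (P : MvPolynomial σ K)
    (f : MvPowerSeries σ K) :
    multisection d ((MvPolynomial.expand d P : MvPolynomial σ K) * f : MvPowerSeries σ K) =
      (P : MvPowerSeries σ K) * multisection d f := by
  classical
  ext e
  rw [coeff_multisection, MvPowerSeries.coeff_mul, MvPowerSeries.coeff_mul]
  symm
  refine Finset.sum_of_injOn (fun p => (d • p.1, d • p.2)) ?_ ?_ ?_ ?_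
  · rintro ⟨a, b⟩ _ ⟨a', b'⟩ _ h
    simp only [Prod.mk.injEq] at h
    exact Prod.ext (smul_finsupp_injective hd h.1) (smul_finsupp_injective hd h.2)
  · rintro ⟨a, b⟩ h
    simp only [Finset.mem_coe, Finset.HasAntidiagonal.mem_antidiagonal] at h ⊢
    rw [← smul_add, h]
  · rintro ⟨a, b⟩ h hn
    by_contra h0
    obtain ⟨a', rfl⟩ := exists_smul_eq_of_coeff_expand_ne_zero (d := d) P (e := a) (by
      intro h1
      exact h0 (by simp [h1]))
    refine hn ⟨(a', e - a'), ?_, ?_⟩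
    · simp only [Finset.mem_coe, Finset.HasAntidiagonal.mem_antidiagonal] at h ⊢
      refine add_tsub_cancel_of_le (Finsupp.le_def.2 fun i => ?_)
      have := DFunLike.congr_fun h i
      simp only [Finsupp.coe_add, Finsupp.coe_smul, Pi.add_apply, Pi.smul_apply,
        smul_eq_mul] at this
      exact Nat.le_of_mul_le_mul_left (this ▸ Nat.le_add_right _ _) (Nat.pos_of_ne_zero hd)
    · simp only [Finset.HasAntidiagonal.mem_antidiagonal] at h
      ext i
      · rfl
      · have := DFunLike.congr_fun h i
        simp only [Finsupp.coe_add, Finsupp.coe_smul, Pi.add_apply, Pi.smul_apply,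
          smul_eq_mul] at this
        simp only [Finsupp.coe_smul, Finsupp.coe_tsub, Pi.smul_apply, Pi.sub_apply, smul_eq_mul,
          Nat.mul_sub]
        omega
  · rintro ⟨a, b⟩ h
    simp [MvPolynomial.coeff_expand_smul, hd]

theorem exists_multisection_coe {d : ℕ} (hd : d ≠ 0) (P : MvPolynomial σ K) :
    ∃ R : MvPolynomial σ K, (R : MvPowerSeries σ K) = multisection d (P : MvPowerSeries σ K) :=
  exists_coe_eq_of_finite _ ((finite_coeff_coe_ne_zero P).preimage
    (smul_finsupp_injective hd).injOn)

/-- Every polynomial with nonzero constant term divides a polynomial in the `d`-th powers of the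
variables with nonzero constant term. -/
theorem exists_mul_eq_expand {d : ℕ} (hd : d ≠ 0) (Q : MvPolynomial σ K)
    (hQ : MvPolynomial.constantCoeff Q ≠ 0) :
    ∃ R Q' : MvPolynomial σ K, MvPolynomial.constantCoeff Q' ≠ 0 ∧
      R * Q = MvPolynomial.expand d Q' := by
  set c := MvPolynomial.constantCoeff Q
  let A := (MvPolynomial.expand d : MvPolynomial σ K →ₐ[K] MvPolynomial σ K).range
  let ε : A →+* K := (MvPolynomial.constantCoeff).comp A.val.toRingHom
  have hint : Algebra.IsIntegral A (MvPolynomial σ K) := by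
    refine ⟨fun P => ?_⟩
    induction P using MvPolynomial.induction_on with
    | C r => exact isIntegral_algebraMap (x := algebraMap K A r)
    | add p q hp hq => exact hp.add hq
    | mul_X p i hp =>
      refine hp.mul (IsIntegral.of_pow (Nat.pos_of_ne_zero hd) ?_)
      exact isIntegral_algebraMap (x := (⟨MvPolynomial.X i ^ d, MvPolynomial.X i, by simp⟩ : A))
  have hle : MvPolynomial.idealOfVars σ K ≤
      ((RingHom.ker ε).map (algebraMap A (MvPolynomial σ K))).radical := by
    rw [MvPolynomial.idealOfVars, Ideal.span_le]
    rintro _ ⟨i, rfl⟩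
    refine ⟨d, ?_⟩
    refine Ideal.mem_map_of_mem (algebraMap A (MvPolynomial σ K))
      (x := (⟨MvPolynomial.X i ^ d, MvPolynomial.X i, by simp⟩ : A)) ?_
    simp [ε, RingHom.mem_ker, hd]
  have hq : MvPolynomial.C c - Q ∈ MvPolynomial.idealOfVars σ K := by
    rw [← pow_one (MvPolynomial.idealOfVars σ K), MvPolynomial.mem_pow_idealOfVars_iff']
    intro x hx
    obtain rfl : x = 0 := (Finsupp.degree_eq_zero_iff x).1 (Nat.lt_one_iff.1 hx)
    simp [c, MvPolynomial.constantCoeff_eq]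
  obtain ⟨D, hD⟩ := hle hq
  -- `p` is monic over `A`, kills `(c - Q)^D`, and has its lower coefficients in `ker ε`. Its value
  -- at `c^D` is therefore a multiple of `c^D - (c - Q)^D`, hence of `Q`, and has constant term a
  -- power of `c`.
  obtain ⟨p, hp, hp0, hpI⟩ := Polynomial.exists_monic_aeval_eq_zero_forall_mem_of_mem_map hD
  set a : A := algebraMap K A c ^ D
  obtain ⟨Q', hQ'⟩ := (p.eval a).2
  have hdvd : Q ∣ ((p.eval a : A) : MvPolynomial σ K) := by
    have h1 : ((p.eval a : A) : MvPolynomial σ K) =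
        (p.map (algebraMap A (MvPolynomial σ K))).eval (MvPolynomial.C c ^ D) := by
      have := Polynomial.hom_eval₂ p (RingHom.id A) (algebraMap A (MvPolynomial σ K)) a
      rw [Polynomial.eval_map]
      simpa [a] using this
    have h2 : (p.map (algebraMap A (MvPolynomial σ K))).eval ((MvPolynomial.C c - Q) ^ D) = 0 := by
      rw [Polynomial.eval_map]
      exact hp0
    rw [h1, ← sub_zero (Polynomial.eval _ _), ← h2]
    refine dvd_trans ?_ (Polynomial.sub_dvd_eval_sub _ _ _)
    refine dvd_trans ?_ (sub_dvd_pow_sub_pow _ _ D)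
    simp
  obtain ⟨R, hR⟩ := hdvd
  refine ⟨R, Q', ?_, ?_⟩
  · have h1 : MvPolynomial.constantCoeff Q' = ε (p.eval a) := by
      change _ = MvPolynomial.constantCoeff ((p.eval a : A) : MvPolynomial σ K)
      rw [← hQ']
      exact (MvPolynomial.coeff_expand_zero d hd Q').symm
    have h2 : p.map ε = Polynomial.X ^ p.natDegree := by
      ext i
      rw [Polynomial.coeff_map, Polynomial.coeff_X_pow]
      split_ifs with h
      · rw [h, hp.coeff_natDegree, map_one]
      · exact hpI i h
    have h3 : ε (p.eval a) = (p.map ε).eval (ε a) := by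
      rw [Polynomial.eval_map, Polynomial.eval₂_hom]
    rw [h1, h3, h2]
    simp only [Polynomial.eval_pow, Polynomial.eval_X]
    refine pow_ne_zero _ ?_
    simp only [a, map_pow]
    refine pow_ne_zero _ ?_
    change MvPolynomial.constantCoeff (MvPolynomial.C c) ≠ 0
    simpa using hQ
  · rw [mul_comm, ← hR, ← hQ']
    rfl

end Multisection

theorem IsRegularRational.multisection {n d : ℕ} (hd : d ≠ 0)
    {h : MvPowerSeries (Fin (n + 1)) K} (hh : IsRegularRational h) :
    IsRegularRational (multisection d h) := by
  obtain ⟨P, Q, hQ, e⟩ := hh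
  obtain ⟨R, Q', hQ', e'⟩ := exists_mul_eq_expand hd Q hQ
  obtain ⟨P', hP'⟩ := exists_multisection_coe hd (R * P)
  refine ⟨P', Q', hQ', ?_⟩
  rw [hP', ← multisection_expand_mul hd, ← e', MvPolynomial.coe_mul, MvPolynomial.coe_mul,
    mul_assoc, e]

/-! ### Furstenberg's formula: a simple root as a partial diagonal. -/

section Furstenberg

variable {n : ℕ}

/-- Exponents in `t_0, …, t_n` seen as exponents in `y, t_0, …, t_n`. -/
def tailEmb (n : ℕ) : (Fin (n + 1) →₀ ℕ) →+ (Fin (n + 1 + 1) →₀ ℕ) :=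
  Finsupp.mapDomain.addMonoidHom Fin.succ

/-- The exponent map of the substitution `t_0 ↦ t_0 * y` into series in `t_0, …, t_n`. -/
def balancedEmb (n : ℕ) : (Fin (n + 1) →₀ ℕ) →+ (Fin (n + 1 + 1) →₀ ℕ) :=
  tailEmb n + (Finsupp.singleAddHom 0).comp (Finsupp.applyAddHom 0)

/-- The exponent map of the substitution `t_0 ↦ t_0 * y` into series in `y, t_0, …, t_n`. -/
def shearEmb (n : ℕ) : (Fin (n + 1 + 1) →₀ ℕ) →+ (Fin (n + 1 + 1) →₀ ℕ) :=
  AddMonoidHom.id _ + (Finsupp.singleAddHom 0).comp (Finsupp.applyAddHom 1)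

@[simp]
theorem tailEmb_zero (u : Fin (n + 1) →₀ ℕ) : tailEmb n u 0 = 0 :=
  Finsupp.mapDomain_of_notMem_range _ _ (by simp)

@[simp]
theorem tailEmb_succ (u : Fin (n + 1) →₀ ℕ) (j : Fin (n + 1)) : tailEmb n u j.succ = u j :=
  Finsupp.mapDomain_apply (Fin.succ_injective _) _ _

@[simp]
theorem balancedEmb_zero (u : Fin (n + 1) →₀ ℕ) : balancedEmb n u 0 = u 0 := by
  simp [balancedEmb]

@[simp]
theorem balancedEmb_succ (u : Fin (n + 1) →₀ ℕ) (j : Fin (n + 1)) :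
    balancedEmb n u j.succ = u j := by
  simp [balancedEmb]

@[simp]
theorem balancedEmb_one (u : Fin (n + 1) →₀ ℕ) : balancedEmb n u 1 = u 0 :=
  balancedEmb_succ u 0

theorem shearEmb_zero (e : Fin (n + 1 + 1) →₀ ℕ) : shearEmb n e 0 = e 0 + e 1 := by
  simp [shearEmb]

theorem shearEmb_succ (e : Fin (n + 1 + 1) →₀ ℕ) (j : Fin (n + 1)) :
    shearEmb n e j.succ = e j.succ := by
  simp [shearEmb]

theorem shearEmb_one (e : Fin (n + 1 + 1) →₀ ℕ) : shearEmb n e 1 = e 1 :=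
  shearEmb_succ e 0

theorem tailEmb_injective : Function.Injective (tailEmb n) :=
  Finsupp.mapDomain_injective (Fin.succ_injective _)

theorem balancedEmb_injective : Function.Injective (balancedEmb n) := by
  intro u v h
  ext j
  simpa using DFunLike.congr_fun h j.succ

theorem shearEmb_injective : Function.Injective (shearEmb n) := by
  intro u v h
  have hs : ∀ j : Fin (n + 1), u j.succ = v j.succ := fun j => by
    simpa [shearEmb_succ] using DFunLike.congr_fun h j.succ
  ext j
  refine Fin.cases ?_ hs j
  have h0 := DFunLike.congr_fun h 0
  have h1 := hs 0
  rw [shearEmb_zero, shearEmb_zero] at h0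
  simp only [Fin.succ_zero_eq_one] at h1
  omega

theorem shearEmb_tailEmb (u : Fin (n + 1) →₀ ℕ) : shearEmb n (tailEmb n u) = balancedEmb n u := by
  ext j
  refine Fin.cases ?_ (fun j => ?_) j
  · rw [shearEmb_zero, tailEmb_zero, balancedEmb_zero, zero_add]
    exact tailEmb_succ u 0
  · rw [shearEmb_succ, tailEmb_succ, balancedEmb_succ]

theorem balancedEmb_le_iff {u v : Fin (n + 1) →₀ ℕ} :
    balancedEmb n u ≤ balancedEmb n v ↔ u ≤ v := by
  constructor
  · intro h j
    simpa using h j.succ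
  · intro h j
    refine Fin.cases ?_ (fun j => ?_) j
    · simpa using h 0
    · simpa using h j

theorem monomialMap_balancedEmb_X_mul (ζ : MvPowerSeries (Fin (n + 1)) K) :
    monomialMap (balancedEmb n) balancedEmb_injective (MvPowerSeries.X 0 * ζ) =
      MvPowerSeries.X 0 * (MvPowerSeries.X 1 *
        monomialMap (balancedEmb n) balancedEmb_injective ζ) := by
  have h : balancedEmb n (Finsupp.single 0 1) = Finsupp.single 0 1 + Finsupp.single 1 1 := by
    simp [balancedEmb, tailEmb, add_comm]
  rw [map_mul, ← mul_assoc, MvPowerSeries.X_def, MvPowerSeries.X_def, MvPowerSeries.X_def,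
    monomialMap_monomial, MvPowerSeries.monomial_mul_monomial, one_mul, h]

/-- The coefficients of `y * (t_0 * Z)^k` at balanced exponents, where `Z` is balanced. -/
theorem coeff_balancedEmb_X_mul_pow {k : ℕ} (hk : k ≠ 1) (ζ : MvPowerSeries (Fin (n + 1)) K)
    (u : Fin (n + 1) →₀ ℕ) :
    MvPowerSeries.coeff (balancedEmb n u) (MvPowerSeries.X 0 * (MvPowerSeries.X 1 *
      monomialMap (balancedEmb n) balancedEmb_injective ζ) ^ k) = 0 := by
  classical
  rw [mul_pow, ← map_pow, ← mul_assoc, MvPowerSeries.X_pow_eq, MvPowerSeries.X_def,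
    MvPowerSeries.monomial_mul_monomial, MvPowerSeries.coeff_monomial_mul]
  split_ifs with h
  · rw [coeff_monomialMap_of_notMem, mul_zero]
    intro v hv
    have h0 := DFunLike.congr_fun hv 0
    have h1 := DFunLike.congr_fun hv 1
    have l0 := h 0
    have l1 := h 1
    simp at h0 h1 l0 l1
    omega
  · rfl

/-- A series divisible by `y^2` times a series in `t_0 * y, t_1, …, t_n, y` has no balanced
exponents. -/
theorem coeff_balancedEmb_X_sq_mul (W : MvPowerSeries (Fin (n + 1 + 1)) K)
    (u : Fin (n + 1) →₀ ℕ) :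
    MvPowerSeries.coeff (balancedEmb n u) (MvPowerSeries.X 0 ^ 2 *
      monomialMap (shearEmb n) shearEmb_injective W) = 0 := by
  classical
  rw [MvPowerSeries.X_pow_eq, MvPowerSeries.coeff_monomial_mul]
  split_ifs with h
  · rw [coeff_monomialMap_of_notMem, mul_zero]
    intro v hv
    have h0 := DFunLike.congr_fun hv 0
    have h1 := DFunLike.congr_fun hv 1
    have l0 := h 0
    rw [shearEmb_zero] at h0
    rw [shearEmb_one] at h1
    simp at h0 h1 l0
    omega
  · rfl

/-- With `ω = t_0 Z` and `Z` balanced, `V` is the geometric series `∑ y ω^k`. In `ω^k` the exponent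
of `t_0` exceeds that of `y` by `k`, so only `k = 1` is balanced, and `y ω` is the substituted root.
-/
theorem coeff_balancedEmb_geometric (ζ : MvPowerSeries (Fin (n + 1)) K)
    (u : Fin (n + 1) →₀ ℕ) (V : MvPowerSeries (Fin (n + 1 + 1)) K)
    (hV : (1 - MvPowerSeries.X 1 * monomialMap (balancedEmb n) balancedEmb_injective ζ) * V =
      MvPowerSeries.X 0) :
    MvPowerSeries.coeff (balancedEmb n u) V =
      MvPowerSeries.coeff u (MvPowerSeries.X 0 * ζ) := by
  classical
  set ω : MvPowerSeries (Fin (n + 1 + 1)) K :=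
    MvPowerSeries.X 1 * monomialMap (balancedEmb n) balancedEmb_injective ζ with hω
  -- Large enough that `t_0^N` cannot divide the exponent in question and that `k = 1` lies in the
  -- range of summation.
  set N := u 0 + 2
  have hgeom : V = ∑ k ∈ Finset.range N, MvPowerSeries.X 0 * ω ^ k + ω ^ N * V := by
    have h := mul_neg_geom_sum ω N
    rw [← Finset.mul_sum, ← hV]
    linear_combination (-V) * h
  have hrem : MvPowerSeries.coeff (balancedEmb n u) (ω ^ N * V) = 0 := by
    rw [hω, mul_pow, mul_assoc, MvPowerSeries.X_pow_eq, MvPowerSeries.coeff_monomial_mul,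
      if_neg]
    intro h
    have := h 1
    simp [N] at this
  rw [hgeom, map_add, hrem, add_zero, map_sum, Finset.sum_eq_single 1]
  · rw [pow_one, hω, ← monomialMap_balancedEmb_X_mul, coeff_monomialMap]
  · intro k _ hk
    exact coeff_balancedEmb_X_mul_pow hk ζ u
  · intro h
    simp [N] at h

/-- If `z = t_0 * ζ` is a root of `F` and `∂F/∂Y` does not vanish at the origin, then `z` is the
partial diagonal of a rational function in one more variable. -/
theorem exists_isRegularRational_of_simple_root (F : (MvPolynomial (Fin (n + 1)) K)[X])
    (ζ : MvPowerSeries (Fin (n + 1)) K)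
    (hF : Polynomial.aeval (MvPowerSeries.X 0 * ζ) F = 0)
    (hF1 : MvPolynomial.constantCoeff (F.coeff 1) ≠ 0) :
    ∃ H : MvPowerSeries (Fin (n + 1 + 1)) K, IsRegularRational H ∧
      ∀ u, MvPowerSeries.coeff (balancedEmb n u) H =
        MvPowerSeries.coeff u (MvPowerSeries.X 0 * ζ) := by
  set z : MvPowerSeries (Fin (n + 1)) K := MvPowerSeries.X 0 * ζ with hz
  let c := MvPolynomial.coeToMvPowerSeries.ringHom (σ := Fin (n + 1)) (R := K)
  let Λ : (MvPowerSeries (Fin (n + 1)) K)[X] →+* MvPowerSeries (Fin (n + 1 + 1)) K :=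
    Polynomial.eval₂RingHom (monomialMap (tailEmb n) tailEmb_injective) (MvPowerSeries.X 0)
  let s := monomialMap (K := K) (shearEmb n) shearEmb_injective
  let b := monomialMap (K := K) (balancedEmb n) balancedEmb_injective
  let Φ : (MvPowerSeries (Fin (n + 1)) K)[X] →+* MvPowerSeries (Fin (n + 1 + 1)) K :=
    Polynomial.eval₂RingHom b (MvPowerSeries.X 0)
  have hsX : s (MvPowerSeries.X 0) = MvPowerSeries.X 0 := by
    rw [MvPowerSeries.X_def]
    refine (monomialMap_monomial _ _ _ _).trans ?_
    congr 2
    simp [shearEmb]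
  have hΦ : s.comp Λ = Φ := by
    refine Polynomial.ringHom_ext ?_ ?_
    · intro f
      simpa [Λ, Φ] using monomialMap_monomialMap (tailEmb n) tailEmb_injective (shearEmb n)
        shearEmb_injective (balancedEmb n) balancedEmb_injective shearEmb_tailEmb f
    · simpa [Λ, Φ] using hsX
  have hΦ' : ∀ p, s (Λ p) = Φ p := fun p => congrArg (fun G => G p) hΦ
  have hconst : ∀ p, MvPowerSeries.constantCoeff (Φ p) =
      MvPowerSeries.constantCoeff (p.coeff 0) := by
    intro p
    have h := Polynomial.hom_eval₂ p b MvPowerSeries.constantCoeff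
      (MvPowerSeries.X (0 : Fin (n + 1 + 1)))
    simp only [Φ, Polynomial.coe_eval₂RingHom]
    rw [h]
    simp only [MvPowerSeries.constantCoeff_X, Polynomial.eval₂_at_zero, RingHom.comp_apply]
    exact constantCoeff_monomialMap _ _ _
  obtain ⟨U, hU⟩ : (Polynomial.X - Polynomial.C z) ∣ F.map c := by
    rw [Polynomial.dvd_iff_isRoot, Polynomial.IsRoot, Polynomial.eval_map]
    exact hF
  have hz0 : MvPowerSeries.constantCoeff z = 0 := by simp [hz]
  have hU0 : MvPowerSeries.constantCoeff (U.coeff 0) ≠ 0 := by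
    have h := congrArg (fun p => MvPowerSeries.constantCoeff (Polynomial.coeff p 1)) hU
    simp only [Polynomial.coeff_map, sub_mul, Polynomial.coeff_sub, Polynomial.coeff_X_mul,
      Polynomial.coeff_C_mul, map_sub, map_mul, hz0, zero_mul, sub_zero] at h
    rw [← h]
    simpa [c, constantCoeff_coe] using hF1
  -- `Φ F` is a polynomial divisible by `y`
  let ω := MvPowerSeries.X 1 * b ζ
  have hΦz : Φ (Polynomial.X - Polynomial.C z) = MvPowerSeries.X 0 * (1 - ω) := by
    have h : b z = MvPowerSeries.X 0 * ω := monomialMap_balancedEmb_X_mul ζ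
    simp only [map_sub, Φ, Polynomial.coe_eval₂RingHom, Polynomial.eval₂_X, Polynomial.eval₂_C, h]
    ring
  let ΦF : (MvPolynomial (Fin (n + 1)) K)[X] → MvPolynomial (Fin (n + 1 + 1)) K :=
    Polynomial.eval₂ (monomialMapPoly (balancedEmb n)) (MvPolynomial.X 0)
  have hΦF : ∀ p, ((ΦF p : MvPolynomial _ K) : MvPowerSeries _ K) = Φ (p.map c) := by
    intro p
    have h := Polynomial.hom_eval₂ p (monomialMapPoly (balancedEmb n))
      (MvPolynomial.coeToMvPowerSeries.ringHom (R := K)) (MvPolynomial.X (0 : Fin (n + 1 + 1)))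
    refine h.trans ?_
    simp only [Φ, Polynomial.coe_eval₂RingHom, Polynomial.eval₂_map,
      MvPolynomial.coeToMvPowerSeries.ringHom_apply, MvPolynomial.coe_X]
    congr 1
    exact RingHom.ext fun q => coe_monomialMapPoly _ balancedEmb_injective q
  -- The denominator is `F(t_0 y, t_1, …, t_n, y) / y`; dividing by `y` is what makes its constant
  -- term nonzero.
  obtain ⟨Q, hQ⟩ := exists_coe_eq_of_monomial_mul (ΦF F) (Finsupp.single 0 1)
    ((1 - ω) * Φ U) (by
      rw [hΦF, hU, map_mul, hΦz, MvPowerSeries.X_def, mul_assoc])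
  have hΛU : MvPowerSeries.constantCoeff (Λ U) ≠ 0 := by
    rwa [← constantCoeff_monomialMap (shearEmb n) shearEmb_injective, ← hconst, ← hΦ'] at *
  have hω1 : MvPowerSeries.constantCoeff (1 - ω) ≠ 0 := by simp [ω]
  let W := Λ (Polynomial.derivative U) * (Λ U)⁻¹
  have hW : s W * Φ U = Φ (Polynomial.derivative U) := by
    rw [← hΦ', ← hΦ', ← map_mul, mul_assoc, MvPowerSeries.inv_mul_cancel _ hΛU, mul_one]
  let V := (1 - ω)⁻¹ * MvPowerSeries.X 0
  have hV : (1 - ω) * V = MvPowerSeries.X 0 := by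
    rw [← mul_assoc, MvPowerSeries.mul_inv_cancel _ hω1, one_mul]
  -- From `F = (Y - z) U`, logarithmic differentiation splits `y² F_Y / F` into `y / (1 - ω)` and
  -- `y² U_Y / U`; the latter has no balanced monomials.
  refine ⟨V + MvPowerSeries.X 0 ^ 2 * s W, ⟨MvPolynomial.X 0 * ΦF (Polynomial.derivative F), Q,
    ?_, ?_⟩, ?_⟩
  · rw [← constantCoeff_coe, hQ, map_mul, hconst]
    exact mul_ne_zero hω1 hU0
  · rw [hQ, MvPolynomial.coe_mul, MvPolynomial.coe_X, hΦF, ← Polynomial.derivative_map, hU,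
      Polynomial.derivative_mul, map_add, map_mul Φ, map_mul Φ, hΦz]
    simp only [Polynomial.derivative_sub, Polynomial.derivative_X, Polynomial.derivative_C,
      sub_zero, map_one, one_mul]
    linear_combination Φ U * hV + (1 - ω) * MvPowerSeries.X 0 ^ 2 * hW
  · intro u
    rw [map_add, coeff_balancedEmb_X_sq_mul, add_zero]
    exact coeff_balancedEmb_geometric ζ u V hV

end Furstenberg

/-! ### Weights and Newton's method: reduction to a simple root. -/

section SimpleRoot

/-- Minimize the first coordinate and recurse on that slice. Giving the first coordinate a weight
above the total weight of the tail of `v` makes every larger first coordinate lose. -/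
theorem exists_weight_strict : ∀ {n : ℕ} (S : Set (Fin n → ℕ)), S.Nonempty →
    ∃ v ∈ S, ∃ w : Fin n → ℕ, (∀ i, 0 < w i) ∧
      ∀ u ∈ S, u ≠ v → ∑ i, w i * v i < ∑ i, w i * u i := by
  intro n
  induction n with
  | zero =>
    rintro S ⟨v, hv⟩
    exact ⟨v, hv, fun _ => 1, fun _ => one_pos, fun u _ h => (h (Subsingleton.elim _ _)).elim⟩
  | succ n ih =>
    intro S hS
    obtain ⟨u₀, hu₀, hmin⟩ : ∃ u₀ ∈ S, ∀ u ∈ S, u₀ 0 ≤ u 0 := by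
      obtain ⟨_, ⟨u₀, hu₀, rfl⟩, h⟩ := WellFounded.has_min (wellFounded_lt (α := ℕ))
        ((fun u : Fin (n + 1) → ℕ => u 0) '' S) (hS.image _)
      exact ⟨u₀, hu₀, fun u hu => not_lt.1 (h _ ⟨u, hu, rfl⟩)⟩
    obtain ⟨v, hv, w, hw, hvw⟩ := ih {t | Fin.cons (u₀ 0) t ∈ S}
      ⟨Fin.tail u₀, by simpa [Fin.cons_self_tail] using hu₀⟩
    refine ⟨Fin.cons (u₀ 0) v, hv, Fin.cons (∑ i, w i * v i + 1) w, ?_, ?_⟩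
    · exact Fin.cases (by simp) (by simpa using hw)
    · intro u hu huv
      simp only [Fin.sum_univ_succ, Fin.cons_zero, Fin.cons_succ]
      rcases (hmin u hu).eq_or_lt with h | h
      · have := hvw (Fin.tail u) (by
          simpa [h, Fin.cons_self_tail] using hu) (by
          rintro rfl
          exact huv (by rw [h, Fin.cons_self_tail]))
        rw [h]
        exact Nat.add_lt_add_left this _
      · have h1 : (∑ i, w i * v i + 1) * (u₀ 0 + 1) ≤ (∑ i, w i * v i + 1) * u 0 :=
          Nat.mul_le_mul_left _ h
        have h2 : 0 ≤ ∑ i : Fin n, w i * u i.succ := Nat.zero_le _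
        linarith

/-- Scaling strictly separating weights by `v.degree + 1` turns a gap of at least one into a gap
exceeding every `v j`. Thus the image of `v` under `weightEmb w` is minimal in each coordinate. -/
theorem exists_weight {n : ℕ} (S : Set (Fin n →₀ ℕ)) (hS : S.Nonempty) :
    ∃ v ∈ S, ∃ w : Fin n → ℕ, (∀ i, 0 < w i) ∧
      ∀ u ∈ S, ∀ j, v j + ∑ i, w i * v i ≤ u j + ∑ i, w i * u i := by
  obtain ⟨_, ⟨v, hv, rfl⟩, w, hw, h⟩ := exists_weight_strict
    ((fun u : Fin n →₀ ℕ => (u : Fin n → ℕ)) '' S)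
    (hS.image _)
  refine ⟨v, hv, fun i => (v.degree + 1) * w i, fun i => by have := hw i; positivity, ?_⟩
  intro u hu j
  by_cases huv : u = v
  · rw [huv]
  · have h1 : ∑ i, w i * v i + 1 ≤ ∑ i, w i * u i :=
      h u ⟨u, hu, rfl⟩ fun h => huv (DFunLike.coe_injective h)
    have h2 := Nat.mul_le_mul_left (v.degree + 1) h1
    have h3 : v j ≤ v.degree := Finsupp.le_degree j v
    simp only [mul_assoc, ← Finset.mul_sum]
    nlinarith

/-- The exponent map of the substitution `x_i ↦ t_i * (t_0 * ⋯ * t_n) ^ w_i`. -/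
def weightEmb {n : ℕ} (w : Fin n → ℕ) : (Fin n →₀ ℕ) →+ (Fin n →₀ ℕ) where
  toFun u := u + (∑ i, w i * u i) • Finsupp.equivFunOnFinite.symm fun _ => 1
  map_zero' := by simp
  map_add' u v := by
    simp only [Finsupp.coe_add, Pi.add_apply, mul_add, Finset.sum_add_distrib, add_smul]
    abel

theorem weightEmb_apply {n : ℕ} (w : Fin n → ℕ) (u : Fin n →₀ ℕ) (j : Fin n) :
    weightEmb w u j = u j + ∑ i, w i * u i := by
  simp [weightEmb]

/-- If `u` had a larger weighted sum than `v`, then `u` would be coordinatewise below `v`, a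
contradiction. -/
theorem weightEmb_injective {n : ℕ} (w : Fin n → ℕ) : Function.Injective (weightEmb w) := by
  intro u v h
  have hj : ∀ j, u j + ∑ i, w i * u i = v j + ∑ i, w i * v i := fun j => by
    rw [← weightEmb_apply, ← weightEmb_apply, h]
  have key : ∀ a b : Fin n →₀ ℕ, (∀ j, a j + ∑ i, w i * a i = b j + ∑ i, w i * b i) →
      ∑ i, w i * a i ≤ ∑ i, w i * b i := by
    intro a b hab
    by_contra! hlt
    refine absurd (Finset.sum_le_sum fun i _ => Nat.mul_le_mul_left (w i) ?_) (not_le.2 hlt)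
    have := hab i
    omega
  have := le_antisymm (key u v hj) (key v u fun j => (hj j).symm)
  ext j
  have := hj j
  omega

/-- Makes truncation by total degree effective: the discarded terms become divisible by any
prescribed monomial. -/
theorem degree_le_weightEmb {n : ℕ} (w : Fin n → ℕ) (hw : ∀ i, 0 < w i) (u : Fin n →₀ ℕ)
    (j : Fin n) : u.degree ≤ weightEmb w u j := by
  rw [weightEmb_apply, Finsupp.degree_eq_sum]
  refine le_add_left (Finset.sum_le_sum fun i _ => ?_)
  exact Nat.le_mul_of_pos_left _ (hw i)

/-- Differentiate an annihilating polynomial as long as its derivative still kills `g`. In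
characteristic zero the degree drops without reaching `0`, and a nonzero constant cannot kill `g`.
-/
theorem exists_aeval_eq_zero_derivative_ne_zero {R A : Type*} [CommRing R] [IsDomain R]
    [CharZero R] [CommRing A] [Algebra R A] (hinj : Function.Injective (algebraMap R A)) {g : A}
    (hg : IsAlgebraic R g) :
    ∃ p : R[X], Polynomial.aeval g p = 0 ∧ Polynomial.aeval g (Polynomial.derivative p) ≠ 0 := by
  obtain ⟨p, hp, hpg⟩ := hg
  induction hd : p.natDegree using Nat.strong_induction_on generalizing p with
  | _ d ih =>
    by_cases h : Polynomial.aeval g (Polynomial.derivative p) = 0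
    · have hd0 : p.natDegree ≠ 0 := by
        intro h0
        obtain ⟨c, rfl⟩ := Polynomial.natDegree_eq_zero.1 h0
        rw [Polynomial.aeval_C, map_eq_zero_iff _ hinj] at hpg
        exact hp (by rw [hpg, map_zero])
      refine ih _ (hd ▸ Polynomial.natDegree_derivative_lt hd0) _ ?_ h rfl
      intro h0
      exact hd0 (Polynomial.derivative_eq_zero.1 h0)
    · exact ⟨p, hpg, h⟩

theorem algebraMap_mvPowerSeries_apply {σ : Type*} (P : MvPolynomial σ K) :
    algebraMap (MvPolynomial σ K) (MvPowerSeries σ K) P = P := by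
  rw [MvPowerSeries.algebraMap_apply']
  simp

theorem algebraMap_mvPowerSeries_injective {σ : Type*} :
    Function.Injective (algebraMap (MvPolynomial σ K) (MvPowerSeries σ K)) := by
  intro P Q h
  rw [algebraMap_mvPowerSeries_apply, algebraMap_mvPowerSeries_apply] at h
  exact MvPolynomial.coe_injective _ _ h

theorem monomialMap_aeval {σ τ : Type*} (φ : (σ →₀ ℕ) →+ (τ →₀ ℕ)) (hφ : Function.Injective φ)
    (g : MvPowerSeries σ K) (p : (MvPolynomial σ K)[X]) :
    monomialMap φ hφ (Polynomial.aeval g p) =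
      Polynomial.aeval (monomialMap φ hφ g) (p.map (monomialMapPoly φ)) := by
  rw [Polynomial.aeval_def, Polynomial.aeval_def, Polynomial.hom_eval₂, Polynomial.eval₂_map]
  congr 1
  refine RingHom.ext fun P => ?_
  simp only [RingHom.comp_apply, algebraMap_mvPowerSeries_apply, coe_monomialMapPoly φ hφ]

theorem coe_eval {σ : Type*} (p : (MvPolynomial σ K)[X]) (T : MvPolynomial σ K) :
    ((p.eval T : MvPolynomial σ K) : MvPowerSeries σ K) =
      Polynomial.aeval (T : MvPowerSeries σ K) p := by
  rw [← algebraMap_mvPowerSeries_apply, ← algebraMap_mvPowerSeries_apply T,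
    Polynomial.aeval_algebraMap_apply_eq_algebraMap_eval]

/-- Newton's argument: a root `T + t^b z` of `q` with `q'(T + t^b z) = t^a e` and `e` a unit
gives, when `b > a` in each coordinate, a polynomial of which `z` is a simple root. -/
theorem exists_simple_root_of_derivative_eq {σ : Type*} (q : (MvPolynomial σ K)[X])
    (T : MvPolynomial σ K) (a s : σ →₀ ℕ) (hs : s ≠ 0) (z e : MvPowerSeries σ K)
    (hq : Polynomial.aeval ((T : MvPowerSeries σ K) + MvPowerSeries.monomial (a + s) 1 * z) q = 0)
    (hq' : Polynomial.aeval ((T : MvPowerSeries σ K) + MvPowerSeries.monomial (a + s) 1 * z)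
      (Polynomial.derivative q) = MvPowerSeries.monomial a 1 * e)
    (he : MvPowerSeries.constantCoeff e ≠ 0) :
    ∃ F : (MvPolynomial σ K)[X], Polynomial.aeval z F = 0 ∧
      MvPolynomial.constantCoeff (F.coeff 1) ≠ 0 := by
  classical
  have hab : (MvPowerSeries.monomial (a + s) 1 : MvPowerSeries σ K) =
      MvPowerSeries.monomial a 1 * MvPowerSeries.monomial s 1 := by
    rw [MvPowerSeries.monomial_mul_monomial, one_mul]
  set ma : MvPowerSeries σ K := MvPowerSeries.monomial a 1 with hma
  set ms : MvPowerSeries σ K := MvPowerSeries.monomial s 1 with hms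
  set G : MvPowerSeries σ K := (T : MvPowerSeries σ K) + MvPowerSeries.monomial (a + s) 1 * z
    with hG
  obtain ⟨r, hr⟩ : ∃ r, Polynomial.aeval G (Polynomial.derivative q) -
      Polynomial.aeval (T : MvPowerSeries σ K) (Polynomial.derivative q) =
        (G - (T : MvPowerSeries σ K)) * r := by
    rw [Polynomial.aeval_def, Polynomial.aeval_def, ← Polynomial.eval_map, ← Polynomial.eval_map]
    exact Polynomial.sub_dvd_eval_sub _ _ _
  -- Moving from the root to `T` changes `q'` by a multiple of `t^(a+s)`, so `q'(T)` is still `t^a`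
  -- times a unit, as `s ≠ 0`.
  have h1 : (((Polynomial.derivative q).eval T : MvPolynomial σ K) : MvPowerSeries σ K) =
      ma * (e - ms * z * r) := by
    rw [coe_eval]
    rw [hq', hG, hab] at hr
    linear_combination -hr
  obtain ⟨p₁, hp₁⟩ := exists_coe_eq_of_monomial_mul _ _ _ h1
  -- Expand `q(T + t^(a+s) Y)` to second order in `Y`. All of it is divisible by `t^(2a+s)`: the
  -- linear term by `h1`, the quadratic term with `t^s` to spare, and `q(T)` because the sum
  -- vanishes at `z`. The quotient is `F`.
  obtain ⟨k, hk⟩ := Polynomial.binomExpansion (q.map Polynomial.C) (Polynomial.C T)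
    (Polynomial.C (MvPolynomial.monomial (a + s) 1) * Polynomial.X)
  have h2 := congrArg (Polynomial.aeval z) hk
  have h3 : Polynomial.aeval z (Polynomial.eval (Polynomial.C T +
      Polynomial.C (MvPolynomial.monomial (a + s) 1) * Polynomial.X) (q.map Polynomial.C)) = 0 := by
    rw [← hq, Polynomial.eval_map]
    refine (Polynomial.aeval_comp (p := q) (x := z)).trans ?_
    simp [algebraMap_mvPowerSeries_apply, hG, MvPolynomial.coe_monomial]
  have h4 : ((q.eval T : MvPolynomial σ K) : MvPowerSeries σ K) =
      MvPowerSeries.monomial (a + (a + s)) 1 *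
        (-((p₁ : MvPowerSeries σ K) * z + ms * Polynomial.aeval z k * z ^ 2)) := by
    have h5 : (MvPowerSeries.monomial (a + (a + s)) 1 : MvPowerSeries σ K) = ma * (ma * ms) := by
      rw [← hab, MvPowerSeries.monomial_mul_monomial, one_mul]
    rw [h3, Polynomial.derivative_map, Polynomial.eval_map, Polynomial.eval_map,
      Polynomial.eval₂_hom, Polynomial.eval₂_hom] at h2
    simp only [map_add, map_mul, map_pow, Polynomial.aeval_C, Polynomial.aeval_X,
      algebraMap_mvPowerSeries_apply, MvPolynomial.coe_monomial, hab, h1] at h2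
    rw [h5, hp₁]
    linear_combination -h2
  obtain ⟨p₀, hp₀⟩ := exists_coe_eq_of_monomial_mul _ _ _ h4
  refine ⟨Polynomial.C p₀ + Polynomial.C p₁ * Polynomial.X +
    Polynomial.C (MvPolynomial.monomial s 1) * k * Polynomial.X ^ 2, ?_, ?_⟩
  · simp only [map_add, map_mul, map_pow, Polynomial.aeval_C, Polynomial.aeval_X,
      algebraMap_mvPowerSeries_apply, hp₀, MvPolynomial.coe_monomial]
    ring
  · have : (Polynomial.C p₀ + Polynomial.C p₁ * Polynomial.X +
        Polynomial.C (MvPolynomial.monomial s 1) * k * Polynomial.X ^ 2).coeff 1 = p₁ := by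
      simp [Polynomial.coeff_mul_X_pow']
    rw [this, ← constantCoeff_coe, hp₁]
    have : MvPowerSeries.constantCoeff ms = 0 := by
      rw [hms, ← MvPowerSeries.coeff_zero_eq_constantCoeff_apply, MvPowerSeries.coeff_monomial,
        if_neg hs.symm]
    simpa [this] using he

end SimpleRoot

/-! ### Algebraic diagonals are rational diagonals in one more variable. -/

section AlgebraicToRational

/-- After a suitable substitution of monomials, an algebraic series is, up to a polynomial and a
monomial factor, a simple root that vanishes on `t_0 = 0`. -/
theorem exists_simple_root_form [CharZero K] {n : ℕ} (g : MvPowerSeries (Fin (n + 1)) K)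
    (hg : IsAlgebraicSeries g) :
    ∃ (w : Fin (n + 1) → ℕ) (T : MvPolynomial (Fin (n + 1)) K) (b : Fin (n + 1) →₀ ℕ)
      (ζ : MvPowerSeries (Fin (n + 1)) K) (F : (MvPolynomial (Fin (n + 1)) K)[X]),
      monomialMap (weightEmb w) (weightEmb_injective w) g =
        (T : MvPowerSeries (Fin (n + 1)) K) +
          MvPowerSeries.monomial b 1 * (MvPowerSeries.X 0 * ζ) ∧
      Polynomial.aeval (MvPowerSeries.X 0 * ζ) F = 0 ∧
      MvPolynomial.constantCoeff (F.coeff 1) ≠ 0 := by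
  classical
  obtain ⟨p, hp, hp'⟩ :=
    exists_aeval_eq_zero_derivative_ne_zero algebraMap_mvPowerSeries_injective hg
  set δ := Polynomial.aeval g (Polynomial.derivative p) with hδ
  obtain ⟨v, hv, w, hw, hvw⟩ := exists_weight {u | MvPowerSeries.coeff u δ ≠ 0} (by
    by_contra h
    refine hp' (MvPowerSeries.ext fun u => ?_)
    by_contra hu
    exact h ⟨u, hu⟩)
  set m := monomialMap (K := K) (weightEmb w) (weightEmb_injective w) with hm
  obtain ⟨e, he⟩ := exists_monomial_mul_eq (m δ) (weightEmb w v) (by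
    intro e he
    obtain ⟨u, rfl, hu⟩ := exists_of_coeff_monomialMap_ne_zero _ _ he
    intro j
    rw [weightEmb_apply, weightEmb_apply]
    exact hvw u hu j)
  have he0 : MvPowerSeries.constantCoeff e ≠ 0 := by
    have h := congrArg (MvPowerSeries.coeff (weightEmb w v + 0)) he
    rw [MvPowerSeries.coeff_add_monomial_mul, one_mul, add_zero, coeff_monomialMap,
      MvPowerSeries.coeff_zero_eq_constantCoeff_apply] at h
    rw [← h]
    exact hv
  let s : Fin (n + 1) →₀ ℕ := Finsupp.equivFunOnFinite.symm fun _ => 1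
  have hs : s ≠ 0 := by
    intro h
    simpa [s] using DFunLike.congr_fun h 0
  let a := weightEmb w v
  -- `a + s` is the precision needed by Newton's argument; the additional `t_0` makes the remaining
  -- root vanish on `t_0 = 0`.
  let c := a + s + Finsupp.single 0 1
  let T₀ := MvPowerSeries.truncTotal c.degree g
  obtain ⟨ζ, hζ⟩ := exists_monomial_mul_eq (m (g - (T₀ : MvPowerSeries (Fin (n + 1)) K))) c (by
    intro e he
    obtain ⟨u, rfl, hu⟩ := exists_of_coeff_monomialMap_ne_zero _ _ he
    intro j
    refine (Finsupp.le_degree j c).trans (le_trans ?_ (degree_le_weightEmb w hw u j))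
    by_contra! h
    refine hu ?_
    rw [map_sub, MvPolynomial.coeff_coe, MvPowerSeries.coeff_truncTotal _ h, sub_self])
  have hG : m g = ((monomialMapPoly (weightEmb w) T₀ : MvPolynomial (Fin (n + 1)) K) :
      MvPowerSeries (Fin (n + 1)) K) +
        MvPowerSeries.monomial (a + s) 1 * (MvPowerSeries.X 0 * ζ) := by
    rw [coe_monomialMapPoly _ (weightEmb_injective w), ← mul_assoc, MvPowerSeries.X_def,
      MvPowerSeries.monomial_mul_monomial, one_mul, ← hζ, map_sub]
    ring
  obtain ⟨F, hF, hF1⟩ := exists_simple_root_of_derivative_eq (p.map (monomialMapPoly (weightEmb w)))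
    (monomialMapPoly (weightEmb w) T₀) a s hs (MvPowerSeries.X 0 * ζ) e
    (by rw [← hG, hm, ← monomialMap_aeval, hp, map_zero])
    (by rw [← hG, hm, Polynomial.derivative_map, ← monomialMap_aeval, ← hδ, ← he]) he0
  exact ⟨w, _, _, ζ, F, hG, hF, hF1⟩

theorem exists_regularRational_of_algebraic [CharZero K] {n : ℕ}
    (g : MvPowerSeries (Fin (n + 1)) K) (hg : IsAlgebraicSeries g) :
    ∃ h : MvPowerSeries (Fin (n + 1 + 1)) K, IsRegularRational h ∧ diagonal g = diagonal h := by
  classical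
  obtain ⟨w, T, b, ζ, F, hG, hF, hF1⟩ := exists_simple_root_form g hg
  obtain ⟨H, ⟨P, Q, hQ, hQH⟩, hH⟩ := exists_isRegularRational_of_simple_root F ζ hF hF1
  let T' := monomialMapPoly (balancedEmb n) T
  let H' : MvPowerSeries (Fin (n + 1 + 1)) K :=
    (T' : MvPowerSeries (Fin (n + 1 + 1)) K) + MvPowerSeries.monomial (balancedEmb n b) 1 * H
  have hH' : IsRegularRational H' := by
    refine ⟨Q * T' + MvPolynomial.monomial (balancedEmb n b) 1 * P, Q, hQ, ?_⟩
    rw [MvPolynomial.coe_add, MvPolynomial.coe_mul, MvPolynomial.coe_mul,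
      MvPolynomial.coe_monomial, ← hQH]
    ring
  have hcoeff : ∀ u, MvPowerSeries.coeff (balancedEmb n u) H' =
      MvPowerSeries.coeff u (monomialMap (weightEmb w) (weightEmb_injective w) g) := by
    intro u
    rw [hG, map_add, map_add, coe_monomialMapPoly _ balancedEmb_injective, coeff_monomialMap,
      MvPowerSeries.coeff_monomial_mul, MvPowerSeries.coeff_monomial_mul]
    simp only [balancedEmb_le_iff]
    split_ifs with h
    · obtain ⟨u', rfl⟩ := exists_add_of_le h
      rw [map_add, add_tsub_cancel_left, add_tsub_cancel_left, hH]
    · rfl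
  have hd : 1 + ∑ i, w i ≠ 0 := by positivity
  -- The weight substitution sends `(i, …, i)` to `d • (i, …, i)` with `d = 1 + ∑ w_i`, and the
  -- balanced lift keeps it diagonal, so taking every `d`-th exponent recovers the original
  -- diagonal.
  refine ⟨multisection (1 + ∑ i, w i) H', hH'.multisection hd, ?_⟩
  ext i
  simp only [diagonal, PowerSeries.coeff_mk, coeff_multisection]
  have h1 : weightEmb w (Finsupp.equivFunOnFinite.symm fun _ => i) =
      (1 + ∑ i, w i) • Finsupp.equivFunOnFinite.symm fun _ => i := by
    ext j
    rw [weightEmb_apply]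
    simp [add_mul, Finset.sum_mul]
  have h2 : balancedEmb n ((1 + ∑ i, w i) • Finsupp.equivFunOnFinite.symm fun _ => i) =
      (1 + ∑ i, w i) • Finsupp.equivFunOnFinite.symm fun _ => i := by
    ext j
    refine Fin.cases ?_ (fun j => ?_) j
    · rw [balancedEmb_zero]
      simp
    · rw [balancedEmb_succ]
      simp
  rw [← h2, hcoeff, ← h1, coeff_monomialMap]

end AlgebraicToRational

/-! ### Weierstrass factorization over algebraic power series. -/

section Factorization

variable {σ : Type*}

/-- Assign each nonzero exponent to a variable occurring in it and split `f` accordingly. This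
identifies the maximal ideal, whose adic completeness is needed for Weierstrass preparation. -/
theorem mem_span_range_X [Finite σ] [Nonempty σ] (f : MvPowerSeries σ K)
    (hf : MvPowerSeries.constantCoeff f = 0) :
    f ∈ Ideal.span (Set.range (MvPowerSeries.X : σ → MvPowerSeries σ K)) := by
  classical
  have := Fintype.ofFinite σ
  have hJ : ∀ u : σ →₀ ℕ, u ≠ 0 → ∃ j, u j ≠ 0 := fun u hu => by
    simpa [Finsupp.ext_iff] using hu
  choose! J hJ using hJ
  have hsum : f = ∑ j, ofCoeff fun u => if u ≠ 0 ∧ J u = j then MvPowerSeries.coeff u f else 0 := by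
    ext u
    rw [map_sum]
    simp only [coeff_ofCoeff]
    by_cases hu : u = 0
    · simpa [hu] using hf
    · simp [hu]
  rw [hsum]
  refine Ideal.sum_mem _ fun j _ => ?_
  obtain ⟨g, hg⟩ := exists_monomial_mul_eq
    (ofCoeff fun u => if u ≠ 0 ∧ J u = j then MvPowerSeries.coeff u f else 0)
    (Finsupp.single j 1) (by
      intro u hu
      rw [coeff_ofCoeff] at hu
      have h := (ite_ne_right_iff.1 hu).1
      rw [Finsupp.single_le_iff]
      exact Nat.one_le_iff_ne_zero.2 (h.2 ▸ hJ u h.1))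
  rw [hg]
  exact Ideal.mul_mem_right _ _ (Ideal.subset_span ⟨j, MvPowerSeries.X_def j⟩)

theorem mem_maximalIdeal_mvPowerSeries (f : MvPowerSeries σ K) :
    f ∈ IsLocalRing.maximalIdeal (MvPowerSeries σ K) ↔ MvPowerSeries.constantCoeff f = 0 := by
  rw [IsLocalRing.mem_maximalIdeal, mem_nonunits_iff, MvPowerSeries.isUnit_iff_constantCoeff,
    isUnit_iff_ne_zero, not_not]

theorem isAdicComplete_mvPowerSeries [Finite σ] [Nonempty σ] :
    IsAdicComplete (IsLocalRing.maximalIdeal (MvPowerSeries σ K)) (MvPowerSeries σ K) := by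
  have h : IsLocalRing.maximalIdeal (MvPowerSeries σ K) =
      Ideal.span (Set.range (MvPowerSeries.X : σ → MvPowerSeries σ K)) := by
    refine le_antisymm (fun f hf => ?_) ?_
    · exact mem_span_range_X f ((mem_maximalIdeal_mvPowerSeries f).1 hf)
    · rw [Ideal.span_le]
      rintro _ ⟨j, rfl⟩
      exact (mem_maximalIdeal_mvPowerSeries _).2 (by simp)
  rw [h]
  infer_instance

/-- Weierstrass preparation for a polynomial in `Y` with coefficients in `K⟦x⟧`. -/
theorem exists_distinguished_mul [Finite σ] [Nonempty σ] (D : (MvPowerSeries σ K)[X]) {N : ℕ}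
    (hN : MvPowerSeries.constantCoeff (D.coeff N) ≠ 0) :
    ∃ S L : (MvPowerSeries σ K)[X], S.Monic ∧
      (∀ i < S.natDegree, MvPowerSeries.constantCoeff (S.coeff i) = 0) ∧
      MvPowerSeries.constantCoeff (L.coeff 0) ≠ 0 ∧ D = S * L := by
  have := isAdicComplete_mvPowerSeries (K := K) (σ := σ)
  obtain ⟨S, h, H⟩ := PowerSeries.exists_isWeierstrassFactorization
    (g := (D : PowerSeries (MvPowerSeries σ K))) (by
      intro h0
      have := congrArg (PowerSeries.coeff N) h0
      rw [PowerSeries.coeff_map, Polynomial.coeff_coe, map_zero, IsLocalRing.residue_eq_zero_iff,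
        mem_maximalIdeal_mvPowerSeries] at this
      exact hN this)
  have hS : S.Monic := H.isDistinguishedAt.monic
  have hdist : ∀ i < S.natDegree, MvPowerSeries.constantCoeff (S.coeff i) = 0 := fun i hi =>
    (mem_maximalIdeal_mvPowerSeries _).1 (H.isDistinguishedAt.mem hi)
  -- Preparation gives only a power series cofactor `h`. Uniqueness of Weierstrass division,
  -- compared with Euclidean division of `D` by the monic `S`, makes `h` a polynomial and the
  -- remainder zero.
  have hdvd : D = S * (D /ₘ S) ∧ h = ((D /ₘ S : (MvPowerSeries σ K)[X]) : PowerSeries _) := by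
    have H' : (S : PowerSeries (MvPowerSeries σ K)).IsWeierstrassFactorization S 1 :=
      ⟨H.isDistinguishedAt, isUnit_one, (mul_one _).symm⟩
    have hdeg : ∀ r : (MvPowerSeries σ K)[X], r.degree < S.degree → r.degree <
        ((S : PowerSeries (MvPowerSeries σ K)).map
          (Ideal.Quotient.mk (IsLocalRing.maximalIdeal (MvPowerSeries σ K)))).order.toNat := by
      intro r hr
      have h1 := H'.natDegree_eq_toNat_order_map
      rw [Polynomial.degree_eq_natDegree hS.ne_zero, h1] at hr
      exact hr
    have key := H.isDistinguishedAt.isWeierstrassDivisorAt'.eq_of_mul_add_eq_mul_add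
      (q := h) (r := 0) (q' := ((D /ₘ S : (MvPowerSeries σ K)[X]) : PowerSeries _))
      (r' := D %ₘ S) (hdeg 0 (by simp [bot_lt_iff_ne_bot, hS.ne_zero]))
      (hdeg _ (Polynomial.degree_modByMonic_lt D hS)) (by
        rw [Polynomial.coe_zero, add_zero, ← H.eq_mul, ← Polynomial.coe_mul, ← Polynomial.coe_add,
          add_comm, Polynomial.modByMonic_add_div])
    refine ⟨?_, key.1⟩
    conv_lhs => rw [← Polynomial.modByMonic_add_div D S, ← key.2, zero_add]
  refine ⟨S, D /ₘ S, hS, hdist, ?_, hdvd.1⟩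
  have hu := PowerSeries.isUnit_iff_constantCoeff.1 H.isUnit
  rw [hdvd.2, ← PowerSeries.coeff_zero_eq_constantCoeff_apply, Polynomial.coeff_coe,
    MvPowerSeries.isUnit_iff_constantCoeff, isUnit_iff_ne_zero] at hu
  exact hu

/-- The coefficients of a monic factor of a polynomial with algebraic coefficients are
algebraic. -/
theorem isAlgebraic_coeff_of_dvd {R A : Type*} [CommRing R] [IsDomain R] [CommRing A] [IsDomain A]
    [Algebra R A] (hinj : Function.Injective (algebraMap R A)) {D : R[X]} (hD : D ≠ 0)
    {S : A[X]} (hS : S.Monic) (hdvd : S ∣ D.map (algebraMap R A)) (i : ℕ) :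
    IsAlgebraic R (S.coeff i) := by
  let F := AlgebraicClosure (FractionRing A)
  have hAF : Function.Injective (algebraMap A F) := by
    rw [IsScalarTower.algebraMap_eq A (FractionRing A) F]
    exact (algebraMap (FractionRing A) F).injective.comp (IsFractionRing.injective A _)
  have hRF : Function.Injective (algebraMap R F) := by
    rw [IsScalarTower.algebraMap_eq R A F]
    exact hAF.comp hinj
  -- Over an algebraic closure `S` splits, and its roots are roots of `D`, hence algebraic over `R`;
  -- so are the coefficients, being polynomials in the roots.
  have hlift := (IsAlgClosed.splits (S.map (algebraMap A F))).mem_lift_of_roots_mem_range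
    (hS.map _) (Subalgebra.algebraicClosure R F).val.toRingHom (by
      intro a ha
      refine ⟨⟨a, ?_⟩, rfl⟩
      refine ⟨D, hD, ?_⟩
      have h1 : (S.map (algebraMap A F)).IsRoot a := Polynomial.isRoot_of_mem_roots ha
      have h2 := h1.dvd (Polynomial.map_dvd (algebraMap A F) hdvd)
      rw [Polynomial.map_map, ← IsScalarTower.algebraMap_eq, Polynomial.IsRoot,
        Polynomial.eval_map] at h2
      exact h2)
  rw [Polynomial.lifts_iff_coeff_lifts] at hlift
  obtain ⟨⟨c, hc⟩, hc'⟩ := hlift i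
  rw [Polynomial.coeff_map] at hc'
  have : IsAlgebraic R (algebraMap A F (S.coeff i)) := hc' ▸ hc
  exact (isAlgebraic_algebraMap_iff hAF).1 this

/-- The ring of algebraic power series. -/
abbrev AlgSeries (σ K : Type*) [Field K] : Subalgebra (MvPolynomial σ K) (MvPowerSeries σ K) :=
  Subalgebra.algebraicClosure (MvPolynomial σ K) (MvPowerSeries σ K)

theorem AlgSeries.isUnit {f : AlgSeries σ K}
    (hf : MvPowerSeries.constantCoeff (f : MvPowerSeries σ K) ≠ 0) : IsUnit f := by
  let _ : Invertible (f : MvPowerSeries σ K) := ⟨(f : MvPowerSeries σ K)⁻¹,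
    MvPowerSeries.inv_mul_cancel _ hf, MvPowerSeries.mul_inv_cancel _ hf⟩
  have h : IsAlgebraic (MvPolynomial σ K) (⅟(f : MvPowerSeries σ K)) := IsAlgebraic.invOf f.2
  refine IsUnit.of_mul_eq_one ⟨_, h⟩ ?_
  ext1
  exact mul_invOf_self (f : MvPowerSeries σ K)

/-- A distinguished polynomial and a polynomial with invertible constant term are coprime. -/
theorem isCoprime_of_distinguished {S L : (AlgSeries σ K)[X]} (hS : S.Monic)
    (hdist : ∀ i < S.natDegree, MvPowerSeries.constantCoeff (S.coeff i : MvPowerSeries σ K) = 0)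
    (hL : MvPowerSeries.constantCoeff (L.coeff 0 : MvPowerSeries σ K) ≠ 0) : IsCoprime S L := by
  have hint : (AdjoinRoot.of S).IsIntegral := by
    have := hS.finite_adjoinRoot
    exact fun x => Algebra.IsIntegral.isIntegral (R := AlgSeries σ K) x
  -- A maximal ideal containing `L` in the quotient by `S` contracts, by integrality, to the series
  -- without constant term. As `S` is distinguished, the ideal contains the class of `Y`, hence
  -- `L.coeff 0`, which is invertible.
  have hunit : IsUnit (AdjoinRoot.mk S L) := by
    by_contra h
    obtain ⟨M, hM, hLM⟩ := exists_max_ideal_of_mem_nonunits h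
    have hmax := Ideal.isMaximal_comap_of_isIntegral_of_isMaximal' (AdjoinRoot.of S) hint M
    have hmem : ∀ c : AlgSeries σ K, c ∈ M.comap (AdjoinRoot.of S) ↔
        MvPowerSeries.constantCoeff (c : MvPowerSeries σ K) = 0 := by
      have : M.comap (AdjoinRoot.of S) = RingHom.ker
          ((MvPowerSeries.constantCoeff).comp (AlgSeries σ K).val.toRingHom) := by
        refine hmax.eq_of_le (RingHom.ker_ne_top _) fun c hc => ?_
        by_contra h0
        exact hmax.ne_top (Ideal.eq_top_of_isUnit_mem _ hc (AlgSeries.isUnit h0))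
      intro c
      rw [this]
      rfl
    have hroot : AdjoinRoot.root S ∈ M := by
      refine hM.isPrime.mem_of_pow_mem S.natDegree ?_
      have h0 := congrArg (AdjoinRoot.mk S) hS.as_sum
      rw [AdjoinRoot.mk_self, map_add, map_pow, AdjoinRoot.mk_X, map_sum] at h0
      rw [eq_neg_of_add_eq_zero_left h0.symm]
      refine M.neg_mem (M.sum_mem fun i hi => ?_)
      rw [map_mul]
      refine M.mul_mem_right _ ?_
      exact (hmem _).2 (hdist i (Finset.mem_range.1 hi))
    refine hL ((hmem _).1 ?_)
    have h1 : AdjoinRoot.mk S L = AdjoinRoot.mk S L.divX * AdjoinRoot.root S +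
        AdjoinRoot.of S (L.coeff 0) := by
      conv_lhs => rw [← Polynomial.divX_mul_X_add L]
      simp
    rw [Ideal.mem_comap, ← add_sub_cancel_left (AdjoinRoot.mk S L.divX * AdjoinRoot.root S)
      (AdjoinRoot.of S (L.coeff 0)), ← h1]
    exact M.sub_mem hLM (M.mul_mem_left _ hroot)
  obtain ⟨v, hv⟩ := hunit.exists_left_inv
  obtain ⟨v, rfl⟩ := AdjoinRoot.mk_surjective v
  rw [← map_mul, ← map_one (AdjoinRoot.mk S), AdjoinRoot.mk_eq_mk] at hv
  obtain ⟨u, hu⟩ := hv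
  exact ⟨-u, v, by linear_combination hu⟩

/-- The Weierstrass factorization descends to algebraic series: the coefficients of `S` are
algebraic by `isAlgebraic_coeff_of_dvd`, and `L` is a quotient by the monic `S`. -/
theorem exists_coprime_factorization [Finite σ] [Nonempty σ] (D : (MvPolynomial σ K)[X]) {N : ℕ}
    (hN : MvPolynomial.constantCoeff (D.coeff N) ≠ 0) :
    ∃ S L : (AlgSeries σ K)[X], S.Monic ∧
      (∀ i < S.natDegree, MvPowerSeries.constantCoeff (S.coeff i : MvPowerSeries σ K) = 0) ∧
      MvPowerSeries.constantCoeff (L.coeff 0 : MvPowerSeries σ K) ≠ 0 ∧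
      IsCoprime S L ∧ D.map (algebraMap (MvPolynomial σ K) (AlgSeries σ K)) = S * L := by
  have hD : D ≠ 0 := by
    rintro rfl
    simp at hN
  obtain ⟨S, L, hS, hdist, hL, hSL⟩ := exists_distinguished_mul
    (D.map (algebraMap (MvPolynomial σ K) (MvPowerSeries σ K))) (N := N) (by
      rwa [Polynomial.coeff_map, algebraMap_mvPowerSeries_apply, constantCoeff_coe])
  have : IsDomain (MvPowerSeries σ K) := NoZeroDivisors.to_isDomain _
  have hSalg := isAlgebraic_coeff_of_dvd algebraMap_mvPowerSeries_injective hD hS ⟨L, hSL⟩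
  let ι : AlgSeries σ K →+* MvPowerSeries σ K := (AlgSeries σ K).val.toRingHom
  have hι : Function.Injective ι := Subtype.val_injective
  obtain ⟨S', hS'⟩ : ∃ S' : (AlgSeries σ K)[X], S'.map ι = S := by
    rw [← Polynomial.mem_lifts, Polynomial.lifts_iff_coeff_lifts]
    exact fun i => ⟨⟨_, hSalg i⟩, rfl⟩
  have hS'm : S'.Monic := Polynomial.monic_of_injective hι (hS' ▸ hS)
  let D' := D.map (algebraMap (MvPolynomial σ K) (AlgSeries σ K))
  have hD' : D'.map ι = S'.map ι * L := by
    rw [hS', ← hSL, Polynomial.map_map]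
    rfl
  obtain ⟨L', hL'⟩ : S' ∣ D' := by
    rw [← Polynomial.map_dvd_map ι hι hS'm]
    exact ⟨L, hD'⟩
  have hLL : L'.map ι = L := by
    rw [hL', Polynomial.map_mul] at hD'
    exact (hS'm.map ι).isRegular.left hD'
  have hdist' : ∀ i < S'.natDegree,
      MvPowerSeries.constantCoeff (S'.coeff i : MvPowerSeries σ K) = 0 := by
    intro i hi
    have := hdist i (by rwa [← hS', hS'm.natDegree_map])
    rwa [← hS', Polynomial.coeff_map] at this
  have hL'0 : MvPowerSeries.constantCoeff (L'.coeff 0 : MvPowerSeries σ K) ≠ 0 := by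
    rwa [← hLL, Polynomial.coeff_map] at hL
  exact ⟨S', L', hS'm, hdist', hL'0, isCoprime_of_distinguished hS'm hdist' hL'0, hL'⟩

end Factorization

/-! ### Rational diagonals as diagonals of algebraic constant terms. -/

section ConstantTerm

variable {n : ℕ}

/-- A series in `y, x_0, …, x_n` as a series in `x_0, …, x_n` with coefficients in `K⟦y⟧`. -/
def sliceHom (n : ℕ) (K : Type*) [Field K] :
    MvPowerSeries (Fin (n + 1 + 1)) K →+* MvPowerSeries (Fin (n + 1)) (PowerSeries K) where
  toFun h := ofCoeff fun u => PowerSeries.mk fun m => MvPowerSeries.coeff (Finsupp.cons m u) h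
  map_zero' := by
    ext
    simp
  map_one' := by
    classical
    ext u m
    rw [coeff_ofCoeff, PowerSeries.coeff_mk, MvPowerSeries.coeff_one, MvPowerSeries.coeff_one]
    by_cases hu : u = 0
    · by_cases hm : m = 0
      · simp [hu, hm]
      · rw [if_neg, if_pos hu, PowerSeries.coeff_one, if_neg hm]
        intro h
        exact hm (by simpa using DFunLike.congr_fun h 0)
    · rw [if_neg, if_neg hu, map_zero]
      intro h
      refine hu (Finsupp.ext fun j => ?_)
      simpa using DFunLike.congr_fun h j.succ
  map_add' f g := by
    ext
    simp
  map_mul' f g := by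
    classical
    ext u m
    simp only [coeff_ofCoeff, PowerSeries.coeff_mk, MvPowerSeries.coeff_mul, map_sum,
      PowerSeries.coeff_mul, Finset.sum_sigma']
    refine Finset.sum_bij' (fun p _ => ⟨(p.1.tail, p.2.tail), (p.1 0, p.2 0)⟩)
      (fun q _ => (Finsupp.cons q.2.1 q.1.1, Finsupp.cons q.2.2 q.1.2)) ?_ ?_ ?_ ?_ ?_
    · rintro ⟨a, b⟩ h
      simp only [Finset.HasAntidiagonal.mem_antidiagonal, Finset.mem_sigma] at h ⊢
      constructor
      · ext j
        simpa [Finsupp.tail_apply] using DFunLike.congr_fun h j.succ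
      · simpa using DFunLike.congr_fun h 0
    · rintro ⟨⟨a, b⟩, ⟨k, l⟩⟩ h
      simp only [Finset.HasAntidiagonal.mem_antidiagonal, Finset.mem_sigma] at h ⊢
      ext j
      refine Fin.cases ?_ (fun j => ?_) j
      · simpa using h.2
      · simpa using DFunLike.congr_fun h.1 j
    · rintro ⟨a, b⟩ h
      simp [Finsupp.cons_tail]
    · rintro ⟨⟨a, b⟩, ⟨k, l⟩⟩ h
      simp [Finsupp.tail_cons]
    · rintro ⟨a, b⟩ h
      simp [Finsupp.cons_tail]

theorem coeff_sliceHom (h : MvPowerSeries (Fin (n + 1 + 1)) K) (u : Fin (n + 1) →₀ ℕ) :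
    MvPowerSeries.coeff u (sliceHom n K h) =
      PowerSeries.mk fun m => MvPowerSeries.coeff (Finsupp.cons m u) h :=
  rfl

/-- The expansion of `h (y, x_0 / y, x_1, …, x_n)` as a series in `x_0, …, x_n` over `K((y))`. -/
def laurentHom (n : ℕ) (K : Type*) [Field K] :
    MvPowerSeries (Fin (n + 1 + 1)) K →+* MvPowerSeries (Fin (n + 1)) (LaurentSeries K) :=
  (MvPowerSeries.rescale
    (Fin.cons (HahnSeries.single (-1) 1) fun _ => 1 : Fin (n + 1) → LaurentSeries K)).comp
    ((MvPowerSeries.map (HahnSeries.ofPowerSeries ℤ K)).comp (sliceHom n K))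

theorem coeff_laurentHom (h : MvPowerSeries (Fin (n + 1 + 1)) K) (u : Fin (n + 1) →₀ ℕ) :
    MvPowerSeries.coeff u (laurentHom n K h) = HahnSeries.single (-(u 0 : ℤ)) 1 *
      HahnSeries.ofPowerSeries ℤ K
        (PowerSeries.mk fun m => MvPowerSeries.coeff (Finsupp.cons m u) h) := by
  rw [laurentHom, RingHom.comp_apply, RingHom.comp_apply, MvPowerSeries.coeff_rescale,
    MvPowerSeries.coeff_map, coeff_sliceHom, Finsupp.prod_fintype _ _ (by simp),
    Fin.prod_univ_succ]
  congr 1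
  simp [HahnSeries.single_pow]

theorem laurentHom_monomial (e : Fin (n + 1 + 1) →₀ ℕ) (r : K) :
    laurentHom n K (MvPowerSeries.monomial e r) =
      MvPowerSeries.monomial e.tail (HahnSeries.single ((e 0 : ℤ) - (e 1 : ℤ)) r) := by
  classical
  ext1 u
  rw [coeff_laurentHom, MvPowerSeries.coeff_monomial]
  split_ifs with h
  · subst h
    have : (PowerSeries.mk fun m => MvPowerSeries.coeff (Finsupp.cons m e.tail)
        (MvPowerSeries.monomial e r)) = PowerSeries.monomial (e 0) r := by
      ext m
      rw [PowerSeries.coeff_mk, MvPowerSeries.coeff_monomial, PowerSeries.coeff_monomial]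
      congr 1
      rw [eq_iff_iff]
      constructor
      · intro h
        simpa using DFunLike.congr_fun h 0
      · rintro rfl
        exact Finsupp.cons_tail e
    have h1 : PowerSeries.monomial (e 0) r = PowerSeries.C r * PowerSeries.X ^ e 0 := by
      ext m
      simp [PowerSeries.coeff_monomial, PowerSeries.coeff_X_pow]
    rw [this, h1, map_mul, HahnSeries.ofPowerSeries_C, HahnSeries.ofPowerSeries_X_pow,
      HahnSeries.C_apply, HahnSeries.single_mul_single, HahnSeries.single_mul_single]
    congr 1
    · rw [Finsupp.tail_apply, Fin.succ_zero_eq_one]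
      ring_nf
    · simp
  · have : (PowerSeries.mk fun m => MvPowerSeries.coeff (Finsupp.cons m u)
        (MvPowerSeries.monomial e r)) = 0 := by
      ext m
      rw [PowerSeries.coeff_mk, MvPowerSeries.coeff_monomial, if_neg, map_zero]
      rintro rfl
      exact h (Finsupp.tail_cons _ _).symm
    rw [this, map_zero (HahnSeries.ofPowerSeries ℤ K), mul_zero]

/-- The constant term in `y`. -/
def constantTerm (n : ℕ) (K : Type*) [Field K] :
    MvPowerSeries (Fin (n + 1)) (LaurentSeries K) →+ MvPowerSeries (Fin (n + 1)) K where
  toFun h := ofCoeff fun u => (MvPowerSeries.coeff u h).coeff 0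
  map_zero' := by
    ext
    simp
  map_add' f g := by
    ext
    simp

theorem coeff_constantTerm (h : MvPowerSeries (Fin (n + 1)) (LaurentSeries K))
    (u : Fin (n + 1) →₀ ℕ) :
    MvPowerSeries.coeff u (constantTerm n K h) = (MvPowerSeries.coeff u h).coeff 0 :=
  rfl

/-- The factor `y^(-u_0)` from `x_0 / y` selects the `y`-exponent `u_0`: the constant term is the
partial diagonal in `y` and `x_0`. -/
theorem coeff_constantTerm_laurentHom (h : MvPowerSeries (Fin (n + 1 + 1)) K)
    (u : Fin (n + 1) →₀ ℕ) :
    MvPowerSeries.coeff u (constantTerm n K (laurentHom n K h)) =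
      MvPowerSeries.coeff (Finsupp.cons (u 0) u) h := by
  rw [coeff_constantTerm, coeff_laurentHom, HahnSeries.coeff_single_mul, one_mul, sub_neg_eq_add,
    zero_add, HahnSeries.ofPowerSeries_apply_coeff, PowerSeries.coeff_mk]

/-- The variable `y`, as a constant of `K((y))⟦x_0, …, x_n⟧`. -/
def yConst (n : ℕ) (K : Type*) [Field K] : MvPowerSeries (Fin (n + 1)) (LaurentSeries K) :=
  MvPowerSeries.C (HahnSeries.single 1 1)

/-- The embedding of `K⟦x_0, …, x_n⟧[Y]` with `Y ↦ y`. -/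
def polyHom (n : ℕ) (K : Type*) [Field K] :
    (MvPowerSeries (Fin (n + 1)) K)[X] →+* MvPowerSeries (Fin (n + 1)) (LaurentSeries K) :=
  Polynomial.eval₂RingHom (MvPowerSeries.map HahnSeries.C) (yConst n K)

theorem laurentHom_C (r : K) :
    laurentHom n K (MvPowerSeries.C r) = MvPowerSeries.C (HahnSeries.C r) := by
  rw [← MvPowerSeries.monomial_zero_eq_C_apply, laurentHom_monomial,
    ← MvPowerSeries.monomial_zero_eq_C_apply]
  have : (0 : Fin (n + 1 + 1) →₀ ℕ).tail = 0 := by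
    ext j
    simp [Finsupp.tail_apply]
  simp [this]

theorem laurentHom_X_zero : laurentHom n K (MvPowerSeries.X 0) = yConst n K := by
  have : (Finsupp.single 0 1 : Fin (n + 1 + 1) →₀ ℕ).tail = 0 := by
    ext j
    simp [Finsupp.tail_apply]
  rw [MvPowerSeries.X_def, laurentHom_monomial, this, MvPowerSeries.monomial_zero_eq_C_apply]
  simp [yConst]

theorem polyHom_C (f : MvPowerSeries (Fin (n + 1)) K) :
    polyHom n K (Polynomial.C f) = MvPowerSeries.map HahnSeries.C f := by
  simp [polyHom]

theorem polyHom_X : polyHom n K Polynomial.X = yConst n K := by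
  simp [polyHom]

theorem exists_polyHom_eq_mul_X_succ (j : Fin (n + 1)) :
    ∃ E : (MvPolynomial (Fin (n + 1)) K)[X],
      polyHom n K (E.map (algebraMap _ _)) =
        yConst n K * laurentHom n K (MvPowerSeries.X j.succ) := by
  classical
  have h1 : (Finsupp.single j.succ 1 : Fin (n + 1 + 1) →₀ ℕ).tail = Finsupp.single j 1 := by
    ext i
    simp [Finsupp.tail_apply, Finsupp.single_apply]
  have h2 : laurentHom n K (MvPowerSeries.X j.succ) = MvPowerSeries.monomial (Finsupp.single j 1)
      (HahnSeries.single (-((Finsupp.single j.succ 1 : Fin (n + 1 + 1) →₀ ℕ) 1 : ℤ)) 1) := by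
    rw [MvPowerSeries.X_def, laurentHom_monomial, h1]
    simp
  have h3 : polyHom n K ((Polynomial.C (MvPolynomial.X j)).map
      (algebraMap (MvPolynomial (Fin (n + 1)) K) (MvPowerSeries (Fin (n + 1)) K))) =
        MvPowerSeries.monomial (Finsupp.single j 1) 1 := by
    rw [Polynomial.map_C, polyHom_C, algebraMap_mvPowerSeries_apply, MvPolynomial.coe_X,
      MvPowerSeries.map_X, MvPowerSeries.X_def]
  refine Fin.cases ?_ (fun i => ?_) j (motive := fun j' => j = j' → _) rfl
  · rintro rfl
    refine ⟨Polynomial.C (MvPolynomial.X 0), ?_⟩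
    rw [h3, h2, yConst, ← MvPowerSeries.monomial_zero_eq_C_apply,
      MvPowerSeries.monomial_mul_monomial, HahnSeries.single_mul_single]
    simp
  · rintro rfl
    refine ⟨Polynomial.X * Polynomial.C (MvPolynomial.X i.succ), ?_⟩
    have h4 : (Finsupp.single i.succ.succ 1 : Fin (n + 1 + 1) →₀ ℕ) 1 = 0 := by
      rw [Finsupp.single_apply, if_neg]
      simp [Fin.ext_iff]
    rw [Polynomial.map_mul, map_mul, h3, h2, Polynomial.map_X, polyHom_X, h4]
    simp

/-- A power of `y` clears the denominators coming from `x_0 / y`. Allowing all large `N` lets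
several polynomials share the same power. -/
theorem exists_polyHom_eq (P : MvPolynomial (Fin (n + 1 + 1)) K) :
    ∃ N₀, ∀ N ≥ N₀, ∃ D : (MvPolynomial (Fin (n + 1)) K)[X],
      polyHom n K (D.map (algebraMap _ _)) =
        yConst n K ^ N * laurentHom n K (P : MvPowerSeries (Fin (n + 1 + 1)) K) := by
  induction P using MvPolynomial.induction_on with
  | C r =>
    refine ⟨0, fun N _ => ⟨Polynomial.X ^ N * Polynomial.C (MvPolynomial.C r), ?_⟩⟩
    rw [MvPolynomial.coe_C, laurentHom_C, Polynomial.map_mul, Polynomial.map_pow, map_mul, map_pow,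
      Polynomial.map_X, polyHom_X, Polynomial.map_C, polyHom_C, algebraMap_mvPowerSeries_apply,
      MvPolynomial.coe_C, MvPowerSeries.map_C]
  | add p q hp hq =>
    obtain ⟨N₁, h₁⟩ := hp
    obtain ⟨N₂, h₂⟩ := hq
    refine ⟨max N₁ N₂, fun N hN => ?_⟩
    obtain ⟨D₁, e₁⟩ := h₁ N (le_of_max_le_left hN)
    obtain ⟨D₂, e₂⟩ := h₂ N (le_of_max_le_right hN)
    refine ⟨D₁ + D₂, ?_⟩
    rw [Polynomial.map_add, map_add, e₁, e₂, MvPolynomial.coe_add, map_add, mul_add]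
  | mul_X p i hp =>
    obtain ⟨N₁, h₁⟩ := hp
    refine ⟨N₁ + 1, fun N hN => ?_⟩
    obtain ⟨M, rfl⟩ : ∃ M, N = M + 1 := ⟨N - 1, by omega⟩
    obtain ⟨D, e⟩ := h₁ M (by omega)
    rw [MvPolynomial.coe_mul, map_mul, MvPolynomial.coe_X]
    refine Fin.cases ?_ (fun j => ?_) i
    · refine ⟨D * Polynomial.X * Polynomial.X, ?_⟩
      rw [Polynomial.map_mul, Polynomial.map_mul, map_mul, map_mul, Polynomial.map_X, polyHom_X, e,
        laurentHom_X_zero]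
      ring
    · obtain ⟨E, hE⟩ := exists_polyHom_eq_mul_X_succ (K := K) j
      refine ⟨D * E, ?_⟩
      rw [Polynomial.map_mul, map_mul, e, hE]
      ring

theorem constantCoeff_polyHom (p : (MvPowerSeries (Fin (n + 1)) K)[X]) :
    MvPowerSeries.constantCoeff (polyHom n K p) = HahnSeries.ofPowerSeries ℤ K
      ((p.map MvPowerSeries.constantCoeff : K[X]) : PowerSeries K) := by
  have : (MvPowerSeries.constantCoeff).comp (polyHom n K) = (HahnSeries.ofPowerSeries ℤ K).comp
      ((Polynomial.coeToPowerSeries.ringHom).comp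
        (Polynomial.mapRingHom MvPowerSeries.constantCoeff)) := by
    refine Polynomial.ringHom_ext (fun f => ?_) ?_
    · simp [polyHom_C]
    · simp [polyHom_X, yConst]
  exact congrArg (fun F => F p) this

theorem coeff_constantCoeff_polyHom (p : (MvPowerSeries (Fin (n + 1)) K)[X]) (N : ℕ) :
    (MvPowerSeries.constantCoeff (polyHom n K p)).coeff (N : ℤ) =
      MvPowerSeries.constantCoeff (p.coeff N) := by
  rw [constantCoeff_polyHom, HahnSeries.ofPowerSeries_apply_coeff, Polynomial.coeff_coe,
    Polynomial.coeff_map]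

/-- The constant term of `b / L`, expanded in `y`. -/
theorem exists_constantTerm_div (b L : (MvPowerSeries (Fin (n + 1)) K)[X])
    (hL : MvPowerSeries.constantCoeff (L.coeff 0) ≠ 0) :
    ∃ c, polyHom n K L * c = polyHom n K b ∧ L.coeff 0 * constantTerm n K c = b.coeff 0 := by
  let Ω : (MvPowerSeries (Fin (n + 1)) K)[X] →+* MvPowerSeries (Fin (n + 1)) (PowerSeries K) :=
    Polynomial.eval₂RingHom (MvPowerSeries.map PowerSeries.C) (MvPowerSeries.C PowerSeries.X)
  have h1 : ∀ p, MvPowerSeries.map (HahnSeries.ofPowerSeries ℤ K) (Ω p) = polyHom n K p := by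
    have : (MvPowerSeries.map (HahnSeries.ofPowerSeries ℤ K)).comp Ω = polyHom n K := by
      refine Polynomial.ringHom_ext (fun f => ?_) ?_
      · rw [polyHom_C]
        ext1 u
        simp [Ω]
      · simp [polyHom_X, yConst, Ω]
    exact fun p => congrArg (fun F => F p) this
  have h2 : ∀ p, MvPowerSeries.map (PowerSeries.constantCoeff (R := K)) (Ω p) = p.coeff 0 := by
    have : (MvPowerSeries.map (PowerSeries.constantCoeff (R := K))).comp Ω =
        Polynomial.constantCoeff := by
      refine Polynomial.ringHom_ext (fun f => ?_) ?_
      · ext1 u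
        simp [Ω]
      · simp [Ω]
    exact fun p => congrArg (fun F => F p) this
  have hu : IsUnit (Ω L) := by
    rw [MvPowerSeries.isUnit_iff_constantCoeff, PowerSeries.isUnit_iff_constantCoeff,
      isUnit_iff_ne_zero]
    rwa [← h2, MvPowerSeries.constantCoeff_map] at hL
  obtain ⟨M, hM⟩ := hu.exists_right_inv
  refine ⟨MvPowerSeries.map (HahnSeries.ofPowerSeries ℤ K) (M * Ω b), ?_, ?_⟩
  · rw [← h1, ← map_mul, ← mul_assoc, hM, one_mul, h1]
  · have h3 : constantTerm n K (MvPowerSeries.map (HahnSeries.ofPowerSeries ℤ K) (M * Ω b)) =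
        MvPowerSeries.map (PowerSeries.constantCoeff (R := K)) (M * Ω b) := by
      ext1 u
      rw [coeff_constantTerm, MvPowerSeries.coeff_map, MvPowerSeries.coeff_map]
      exact (HahnSeries.ofPowerSeries_apply_coeff _ 0).trans
        (PowerSeries.coeff_zero_eq_constantCoeff_apply _)
    rw [h3, ← h2 L, ← map_mul, ← mul_assoc, hM, one_mul, h2]

theorem coeff_zero_eval_inv (q : K[X]) :
    (Polynomial.eval₂ HahnSeries.C (HahnSeries.single (-1 : ℤ) (1 : K)) q).coeff 0 =
      q.coeff 0 := by
  induction q using Polynomial.induction_on' with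
  | add p q hp hq => simp [hp, hq]
  | monomial k r =>
    rw [Polynomial.eval₂_monomial, HahnSeries.single_pow, HahnSeries.C_apply,
      HahnSeries.single_mul_single, Polynomial.coeff_monomial]
    by_cases hk : k = 0
    · simp [hk]
    · rw [if_neg hk, HahnSeries.coeff_single_of_ne]
      simp [eq_comm, hk]

/-- The constant term of `a / S`, expanded in `y⁻¹`. -/
theorem exists_constantTerm_div_distinguished (a S : (MvPowerSeries (Fin (n + 1)) K)[X])
    (hS : S.Monic) (hdist : ∀ i < S.natDegree, MvPowerSeries.constantCoeff (S.coeff i) = 0)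
    (ha : a.degree < S.degree) :
    ∃ c, polyHom n K S * c = polyHom n K a ∧ constantTerm n K c = 0 := by
  let Ω : (MvPowerSeries (Fin (n + 1)) K)[X] →+* MvPowerSeries (Fin (n + 1)) K[X] :=
    Polynomial.eval₂RingHom (MvPowerSeries.map Polynomial.C) (MvPowerSeries.C Polynomial.X)
  let κ : K[X] →+* LaurentSeries K :=
    Polynomial.eval₂RingHom HahnSeries.C (HahnSeries.single (-1 : ℤ) (1 : K))
  let _ : Invertible (yConst n K) := ⟨MvPowerSeries.C (HahnSeries.single (-1) 1),
    by rw [yConst, ← map_mul, HahnSeries.single_mul_single]; simp,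
    by rw [yConst, ← map_mul, HahnSeries.single_mul_single]; simp⟩
  set N := S.natDegree
  -- Factoring out `y^N` writes `p(y)` through its reversal in `y⁻¹`, so that the division takes
  -- place in `K[y⁻¹]⟦x⟧`.
  have h1 : ∀ p : (MvPowerSeries (Fin (n + 1)) K)[X], p.natDegree ≤ N →
      MvPowerSeries.map κ (Ω (p.reflect N)) * yConst n K ^ N = polyHom n K p := by
    have h : (MvPowerSeries.map κ).comp Ω = Polynomial.eval₂RingHom
        (MvPowerSeries.map HahnSeries.C) (⅟(yConst n K)) := by
      refine Polynomial.ringHom_ext (fun f => ?_) ?_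
      · ext1 u
        simp [Ω, κ]
      · simp only [Ω, κ, RingHom.comp_apply, Polynomial.coe_eval₂RingHom, Polynomial.eval₂_X,
          MvPowerSeries.map_C]
        rfl
    intro p hp
    refine Eq.trans ?_ (Polynomial.eval₂_reflect_mul_pow (MvPowerSeries.map HahnSeries.C)
      (yConst n K) N p hp)
    congr 1
    exact congrArg (fun F => F (p.reflect N)) h
  have h2 : ∀ p, MvPowerSeries.map (Polynomial.constantCoeff (R := K)) (Ω p) = p.coeff 0 := by
    have : (MvPowerSeries.map (Polynomial.constantCoeff (R := K))).comp Ω =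
        Polynomial.constantCoeff := by
      refine Polynomial.ringHom_ext (fun f => ?_) ?_
      · ext1 u
        simp [Ω]
      · simp [Ω]
    exact fun p => congrArg (fun F => F p) this
  have h3 : ∀ p, MvPowerSeries.constantCoeff (Ω p) = p.map MvPowerSeries.constantCoeff := by
    have : (MvPowerSeries.constantCoeff).comp Ω =
        Polynomial.mapRingHom MvPowerSeries.constantCoeff := by
      refine Polynomial.ringHom_ext (fun f => ?_) ?_
      · simp [Ω]
      · simp [Ω]
    exact fun p => congrArg (fun F => F p) this
  -- At `x = 0` the distinguished `S` is `y^N`, so its reversal is `1` there.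
  have hu : IsUnit (Ω (S.reflect N)) := by
    have : MvPowerSeries.constantCoeff (Ω (S.reflect N)) = 1 := by
      rw [h3]
      ext i
      rw [Polynomial.coeff_map, Polynomial.coeff_reflect, Polynomial.coeff_one]
      split_ifs with hi
      · rw [hi, Polynomial.revAt_zero, hS.coeff_natDegree, map_one]
      · by_cases hiN : i ≤ N
        · rw [Polynomial.revAt_le hiN, hdist _ (by omega)]
        · rw [Polynomial.revAt_eq_self_of_lt (by omega),
            Polynomial.coeff_eq_zero_of_natDegree_lt (by omega), map_zero]
    rw [MvPowerSeries.isUnit_iff_constantCoeff, this]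
    exact isUnit_one
  obtain ⟨M, hM⟩ := hu.exists_right_inv
  refine ⟨MvPowerSeries.map κ (M * Ω (a.reflect N)), ?_, ?_⟩
  · rw [← h1 S le_rfl, ← h1 a (Polynomial.natDegree_le_natDegree ha.le), mul_right_comm,
      ← map_mul, ← mul_assoc, hM, one_mul]
  · have h4 : constantTerm n K (MvPowerSeries.map κ (M * Ω (a.reflect N))) =
        MvPowerSeries.map (Polynomial.constantCoeff (R := K)) (M * Ω (a.reflect N)) := by
      ext1 u
      rw [coeff_constantTerm, MvPowerSeries.coeff_map, MvPowerSeries.coeff_map]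
      exact coeff_zero_eval_inv _
    -- The constant term of the reversal of `a` is its coefficient of `y^N`, which is zero because
    -- `deg a < N`.
    rw [h4, map_mul, h2, Polynomial.coeff_reflect, Polynomial.revAt_zero,
      Polynomial.coeff_eq_zero_of_degree_lt, mul_zero]
    rwa [← Polynomial.degree_eq_natDegree hS.ne_zero]

theorem exists_eq_mul_add_mul_of_isCoprime {A : Type*} [CommRing A] [Nontrivial A] {S L : A[X]}
    (hS : S.Monic) (hSL : IsCoprime S L) (E : A[X]) :
    ∃ a b : A[X], E = b * S + a * L ∧ a.degree < S.degree := by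
  obtain ⟨u, v, huv⟩ := hSL
  refine ⟨(E * v) %ₘ S, E * u + ((E * v) /ₘ S) * L, ?_, Polynomial.degree_modByMonic_lt _ hS⟩
  linear_combination (-E) * huv - L * Polynomial.modByMonic_add_div (E * v) S

theorem isAlgebraicSeries_constantTerm (h : MvPowerSeries (Fin (n + 1 + 1)) K)
    (hh : IsRegularRational h) : IsAlgebraicSeries (constantTerm n K (laurentHom n K h)) := by
  obtain ⟨P, Q, hQ, hQh⟩ := hh
  obtain ⟨N₁, hN₁⟩ := exists_polyHom_eq Q
  obtain ⟨N₂, hN₂⟩ := exists_polyHom_eq P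
  set N := max N₁ N₂
  obtain ⟨D, hD⟩ := hN₁ N (le_max_left _ _)
  obtain ⟨E, hE⟩ := hN₂ N (le_max_right _ _)
  set R := laurentHom n K h
  have hDR : polyHom n K (D.map (algebraMap _ _)) * R = polyHom n K (E.map (algebraMap _ _)) := by
    rw [hD, hE, ← hQh, map_mul, mul_assoc]
  -- At `x = 0` the polynomial `D` is `y^N Q(y, 0, …, 0)`, so its coefficient of `y^N` is `Q(0)`.
  have hDN : MvPolynomial.constantCoeff (D.coeff N) ≠ 0 := by
    have h1 := coeff_constantCoeff_polyHom (D.map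
      (algebraMap (MvPolynomial (Fin (n + 1)) K) (MvPowerSeries (Fin (n + 1)) K))) N
    rw [Polynomial.coeff_map, algebraMap_mvPowerSeries_apply, constantCoeff_coe] at h1
    rw [← h1, hD, map_mul, map_pow, yConst, MvPowerSeries.constantCoeff_C, HahnSeries.single_pow,
      one_pow, HahnSeries.coeff_single_mul, one_mul]
    have h2 := coeff_constantTerm_laurentHom (Q : MvPowerSeries (Fin (n + 1 + 1)) K) 0
    rw [coeff_constantTerm, MvPolynomial.coeff_coe, Finsupp.coe_zero, Pi.zero_apply,
      Finsupp.cons_zero_zero, ← MvPolynomial.constantCoeff_eq,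
      MvPowerSeries.coeff_zero_eq_constantCoeff_apply] at h2
    simpa [h2] using hQ
  have hD0 : polyHom n K (D.map (algebraMap _ _)) ≠ 0 := by
    intro h0
    have h1 := coeff_constantCoeff_polyHom (D.map
      (algebraMap (MvPolynomial (Fin (n + 1)) K) (MvPowerSeries (Fin (n + 1)) K))) N
    rw [Polynomial.coeff_map, algebraMap_mvPowerSeries_apply, constantCoeff_coe, h0] at h1
    exact hDN (by simpa using h1.symm)
  obtain ⟨S, L, hS, hdist, hL, hcop, hSL⟩ := exists_coprime_factorization D hDN
  let ι : AlgSeries (Fin (n + 1)) K →+* MvPowerSeries (Fin (n + 1)) K :=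
    (AlgSeries _ K).val.toRingHom
  have hι : Function.Injective ι := Subtype.val_injective
  let E' := E.map (algebraMap _ (AlgSeries (Fin (n + 1)) K))
  have hE' : E'.map ι = E.map (algebraMap _ _) := Polynomial.map_map _ _ _
  have hD' : (S * L).map ι = D.map (algebraMap _ _) := by
    rw [← hSL]
    exact Polynomial.map_map _ _ _
  obtain ⟨a, b, hab, hdeg⟩ := exists_eq_mul_add_mul_of_isCoprime hS hcop E'
  obtain ⟨c₁, hc₁, hc₁'⟩ := exists_constantTerm_div (b.map ι) (L.map ι) (by
    rw [Polynomial.coeff_map]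
    exact hL)
  obtain ⟨c₂, hc₂, hc₂'⟩ := exists_constantTerm_div_distinguished (a.map ι) (S.map ι) (hS.map ι)
    (by
      intro i hi
      rw [hS.natDegree_map] at hi
      rw [Polynomial.coeff_map]
      exact hdist i hi)
    (by
      rw [Polynomial.degree_map_eq_of_injective hι, Polynomial.degree_map_eq_of_injective hι]
      exact hdeg)
  -- The two expansions, in `y` and in `y⁻¹`, both lie in the domain `K((y))⟦x⟧`, where the quotient
  -- by `D` is unique.
  have hR : R = c₁ + c₂ := by
    refine mul_left_cancel₀ hD0 ?_
    rw [hDR, ← hE', hab, ← hD', Polynomial.map_add, Polynomial.map_mul, Polynomial.map_mul,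
      Polynomial.map_mul, map_add, map_mul, map_mul, map_mul, ← hc₁, ← hc₂]
    ring
  rw [hR, map_add, hc₂', add_zero]
  obtain ⟨M, hM⟩ := (AlgSeries.isUnit hL).exists_left_inv
  have hM' : (M : MvPowerSeries (Fin (n + 1)) K) * (L.coeff 0 : MvPowerSeries (Fin (n + 1)) K) =
      1 := congrArg Subtype.val hM
  have hfin : constantTerm n K c₁ = ((M * b.coeff 0 : AlgSeries (Fin (n + 1)) K) :
      MvPowerSeries (Fin (n + 1)) K) := by
    rw [Polynomial.coeff_map, Polynomial.coeff_map] at hc₁'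
    change _ = (M : MvPowerSeries (Fin (n + 1)) K) * ι (b.coeff 0)
    rw [← hc₁', ← mul_assoc]
    change _ = (M : MvPowerSeries (Fin (n + 1)) K) *
      (L.coeff 0 : MvPowerSeries (Fin (n + 1)) K) * _
    rw [hM', one_mul]
  rw [hfin]
  exact (M * b.coeff 0).2

theorem exists_algebraic_of_regularRational (h : MvPowerSeries (Fin (n + 1 + 1)) K)
    (hh : IsRegularRational h) :
    ∃ g : MvPowerSeries (Fin (n + 1)) K, IsAlgebraicSeries g ∧ diagonal h = diagonal g := by
  refine ⟨_, isAlgebraicSeries_constantTerm h hh, ?_⟩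
  ext i
  simp only [diagonal, PowerSeries.coeff_mk]
  rw [coeff_constantTerm_laurentHom]
  congr 2
  ext j
  refine Fin.cases ?_ (fun j => ?_) j <;> simp

end ConstantTerm

/-! ### Hadamard products and rational series as diagonals. -/

section Hadamard

theorem coeff_single_toMvPowerSeries {σ : Type*} (i : σ) (f : PowerSeries K) (m : ℕ) :
    MvPowerSeries.coeff (Finsupp.single i m) (f.toMvPowerSeries i) = PowerSeries.coeff m f := by
  have h := MvPowerSeries.coeff_embDomain_rename (Function.Embedding.punit i) f
    (Finsupp.single () m)
  rw [Finsupp.embDomain_single] at h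
  exact h

theorem exists_single_of_coeff_toMvPowerSeries_ne_zero {σ : Type*} (i : σ) (f : PowerSeries K)
    {u : σ →₀ ℕ} (hu : MvPowerSeries.coeff u (f.toMvPowerSeries i) ≠ 0) :
    ∃ m, u = Finsupp.single i m := by
  by_contra! h
  refine hu (MvPowerSeries.coeff_rename_eq_zero (fun _ => i) f ?_)
  rintro ⟨v, rfl⟩
  refine h (v ()) ?_
  conv_lhs => rw [Finsupp.unique_single v, Finsupp.mapDomain_single]

theorem coe_toMvPolynomial {σ : Type*} (i : σ) (p : K[X]) :
    ((p.toMvPolynomial i : MvPolynomial σ K) : MvPowerSeries σ K) =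
      (p : PowerSeries K).toMvPowerSeries i := by
  have : (MvPolynomial.coeToMvPowerSeries.ringHom).comp
      (Polynomial.toMvPolynomial (R := K) i).toRingHom =
      (PowerSeries.toMvPowerSeries i).toRingHom.comp Polynomial.coeToPowerSeries.ringHom := by
    refine Polynomial.ringHom_ext (fun r => ?_) ?_
    · simp
    · simp
  exact congrArg (fun F => F p) this

theorem isAlgebraic_toMvPowerSeries {σ : Type*} (i : σ) {f : PowerSeries K}
    (hf : IsAlgebraic K[X] f) : IsAlgebraic (MvPolynomial σ K) (f.toMvPowerSeries i) := by
  refine hf.ringHom_of_comp_eq (Polynomial.toMvPolynomial (R := K) i)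
    (PowerSeries.toMvPowerSeries i) (Polynomial.toMvPolynomial_injective i) ?_
  refine RingHom.ext fun p => ?_
  simp only [RingHom.comp_apply, algebraMap_mvPowerSeries_apply]
  refine (coe_toMvPolynomial i p).trans ?_
  rfl

/-- The factors involve distinct variables, so a single splitting of `u` contributes. -/
theorem coeff_prod_toMvPowerSeries {k : ℕ} (h : Fin k → PowerSeries K) (u : Fin k →₀ ℕ) :
    MvPowerSeries.coeff u (∏ i, (h i).toMvPowerSeries i) =
      ∏ i, PowerSeries.coeff (u i) (h i) := by
  classical
  rw [MvPowerSeries.coeff_prod, Finset.sum_eq_single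
    (Finsupp.equivFunOnFinite.symm fun i => Finsupp.single i (u i))]
  · exact Finset.prod_congr rfl fun i _ => coeff_single_toMvPowerSeries i (h i) (u i)
  · intro l hl hne
    by_contra h0
    replace h0 := Finset.prod_ne_zero_iff.1 h0
    choose m hm using fun i =>
      exists_single_of_coeff_toMvPowerSeries_ne_zero i (h i) (h0 i (Finset.mem_univ i))
    refine hne (Finsupp.ext fun i => ?_)
    have hsum : ∑ i, l i = u := (Finset.mem_finsuppAntidiag.1 hl).1
    have : u i = m i := by
      rw [← hsum, Finsupp.finsetSum_apply, Finset.sum_eq_single i]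
      · simp [hm i]
      · intro j _ hj
        simp [hm j, hj]
      · simp
    rw [hm i, ← this]
    rfl
  · intro hn
    refine absurd ?_ hn
    rw [Finset.mem_finsuppAntidiag]
    refine ⟨?_, Finset.subset_univ _⟩
    ext i
    simp

theorem exists_algebraic_of_hadamardProd {n : ℕ} (h : Fin (n + 1) → PowerSeries K)
    (hh : ∀ i, IsAlgebraic K[X] (h i)) :
    ∃ g : MvPowerSeries (Fin (n + 1)) K, IsAlgebraicSeries g ∧ hadamardProd h = diagonal g := by
  refine ⟨∏ i, (h i).toMvPowerSeries i, ?_, ?_⟩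
  · exact Subalgebra.prod_mem (AlgSeries (Fin (n + 1)) K)
      fun i _ => isAlgebraic_toMvPowerSeries i (hh i)
  · ext m
    simp [diagonal, hadamardProd, coeff_prod_toMvPowerSeries]

/-- If `X` divides `Q`, it divides `P` as well, since `f` has no pole; cancel and descend on the
degree of `Q`. -/
theorem IsRationalSeries.exists_coeff_zero_ne_zero {f : PowerSeries K} (hf : IsRationalSeries f) :
    ∃ P Q : K[X], Q.coeff 0 ≠ 0 ∧ (Q : PowerSeries K) * f = P := by
  obtain ⟨P, Q, hQ, e⟩ := hf
  induction hd : Q.natDegree using Nat.strong_induction_on generalizing P Q with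
  | _ d ih =>
    by_cases h0 : Q.coeff 0 = 0
    · obtain ⟨Q', rfl⟩ := Polynomial.X_dvd_iff.2 h0
      have hP : P.coeff 0 = 0 := by
        rw [← Polynomial.coeff_coe, ← e]
        simp
      obtain ⟨P', rfl⟩ := Polynomial.X_dvd_iff.2 hP
      have hQ' : Q' ≠ 0 := right_ne_zero_of_mul hQ
      refine ih Q'.natDegree ?_ P' Q' hQ' ?_ rfl
      · rw [← hd, Polynomial.natDegree_X_mul hQ']
        exact Nat.lt_succ_self _
      · rw [Polynomial.coe_mul, Polynomial.coe_mul, Polynomial.coe_X, mul_assoc] at e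
        exact mul_left_cancel₀ PowerSeries.X_ne_zero e
    · exact ⟨P, Q, h0, e⟩

theorem IsRationalSeries.exists_isRegularRational {f : PowerSeries K} (hf : IsRationalSeries f) :
    ∃ h : MvPowerSeries (Fin (0 + 1)) K, IsRegularRational h ∧ f = diagonal h := by
  obtain ⟨P, Q, hQ, e⟩ := hf.exists_coeff_zero_ne_zero
  refine ⟨f.toMvPowerSeries 0, ⟨P.toMvPolynomial 0, Q.toMvPolynomial 0, ?_, ?_⟩, ?_⟩
  · have h1 := coeff_single_toMvPowerSeries (0 : Fin (0 + 1)) (Q : PowerSeries K) 0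
    rw [← coe_toMvPolynomial, Finsupp.single_zero, MvPolynomial.coeff_coe,
      ← MvPolynomial.constantCoeff_eq, Polynomial.coeff_coe] at h1
    rwa [h1]
  · rw [coe_toMvPolynomial, coe_toMvPolynomial, ← map_mul, e]
  · ext i
    have : (Finsupp.equivFunOnFinite.symm fun _ => i : Fin (0 + 1) →₀ ℕ) = Finsupp.single 0 i := by
      ext j
      fin_cases j
      simp
    rw [diagonal, PowerSeries.coeff_mk, this, coeff_single_toMvPowerSeries]

end Hadamard

/-! ### The equivalence and the comparison of grades. -/

theorem exists_algebraic_iff_exists_regularRational [CharZero K] (f : PowerSeries K) (n : ℕ) :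
    (∃ g : MvPowerSeries (Fin (n + 1)) K, IsAlgebraicSeries g ∧ f = diagonal g) ↔
      ∃ h : MvPowerSeries (Fin (n + 1 + 1)) K, IsRegularRational h ∧ f = diagonal h := by
  constructor
  · rintro ⟨g, hg, rfl⟩
    exact exists_regularRational_of_algebraic g hg
  · rintro ⟨h, hh, rfl⟩
    exact exists_algebraic_of_regularRational h hh

theorem diagonalGrade_le_hadamardGrade [CharZero K] (f : PowerSeries K) :
    diagonalGrade f ≤ hadamardGrade f := by
  rw [hadamardGrade]
  split_ifs with hf
  · exact sInf_le ⟨0, rfl, hf.exists_isRegularRational⟩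
  · refine le_sInf ?_
    rintro _ ⟨k, rfl, hk, h, hh, rfl⟩
    -- `k` factors use the variables `x_0, …, x_{k-1}`; the extra variable of the rational function
    -- brings the index from `k - 1` to exactly `k`.
    obtain ⟨n, rfl⟩ : ∃ n, k = n + 1 := ⟨k - 1, by omega⟩
    exact sInf_le ⟨n + 1, rfl, (exists_algebraic_iff_exists_regularRational _ n).1
      (exists_algebraic_of_hadamardProd h hh)⟩

end

end DiagonalGrade

theorem lemmal {K : Type*} [Field K] [NumberField K] (f : PowerSeries K)
    (hf : DiagonalGrade.IsDFinite f) :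
    (∀ n : ℕ,
      (∃ g : MvPowerSeries (Fin (n + 1)) K,
        DiagonalGrade.IsAlgebraicSeries g ∧ f = DiagonalGrade.diagonal g) ↔
      (∃ h : MvPowerSeries (Fin (n + 1 + 1)) K,
        DiagonalGrade.IsRegularRational h ∧ f = DiagonalGrade.diagonal h)) ∧
    DiagonalGrade.diagonalGrade f ≤ DiagonalGrade.hadamardGrade f := by
  exact ⟨fun n => DiagonalGrade.exists_algebraic_iff_exists_regularRational f n,
    DiagonalGrade.diagonalGrade_le_hadamardGrade f⟩
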